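/- Let $\bar\alpha=(\alpha_1,\alpha_2,\alpha_3)$ be a triple of nonzero integers. Consider the following two decision problems, both with size measure $n$. * $3\text{-LDT}(3,\bar\alpha,0)$: given three sets $A_1,A_2,A_3\subseteq\{-n^3,\ldots,n^3\}$ of $n$ integers each, decide whether there are $x_1\in A_1$, $x_2\in A_2$, $x_3\in A_3$ with $\alpha_1x_1+\alpha_2x_2+\alpha_3x_3=0$. * $3\text{-LDT}(1,\bar\alpha,0)$: given a set $X\subseteq\{-n^3,\ldots,n^3\}$ of $n$ integers, decide whether there are distinct $x_1,x_2,x_3\in X$ with $\alpha_1x_1+\alpha_2x_2+\alpha_3x_3=0$. Then $3\text{-LDT}(3,\bar\alpha,0)\le_2 3\text{-LDT}(1,\bar\alpha,0)$, that is, there is a subquadratic reduction from the first problem to the second. Here, a subquadratic reduction from a problem $A$ to a problem $B$ is a deterministic word RAM algorithm $\mathcal A$ (with words of $O(\log m)$ bits on instances of size $m$) with oracle access to $B$, such that for every $\varepsilon>0$ there is $\delta>0$ satisfying: 1. for every instance $x$ of $A$, $\mathcal A(x)$ halts and solves $A$ on $x$; 2. $\mathcal A$ runs in $O(m^{2-\delta})$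 time on instances of size $m$; 3. for all sufficiently large $m$ and every instance $x$ of $A$ of size $m$, if $m_i$ is the size of the $i$-th oracle call to $B$ in $\mathcal A(x)$, then $\sum_i m_i^{2-\varepsilon}\le m^{2-\delta}$. The threshold and the implied constant may depend on $\bar\alpha$, $\varepsilon$ and $\delta$. -/

import Mathlib

/-! ### Decision problems

The inputs of a decision problem are presented to a machine as finite lists of integers.
One input may have several presentations (a set may be listed in any order), but a list
presents at most one input. -/

/-- A decision problem with a size measure on its instances. `Encodes x l` says that the list of
machine words `l` is a presentation of the instance `x`. -/
structure DecisionProblem where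
  Inst : Type
  size : Inst → ℕ
  Yes : Inst → Prop
  Encodes : Inst → List ℤ → Prop
  encodes_unique : ∀ {x y : Inst} {l : List ℤ}, Encodes x l → Encodes y l → x = y

/-! ### A deterministic word RAM with an oracle

Programs are finite `while`-programs over registers and a random access memory whose cells are
addressed by words. A machine word is an integer `z` with `|z| ≤ W`; a program that tries to
compute a value which is not a word gets stuck. Every elementary operation costs one unit of
time, so does every jump, and an oracle call costs in addition the length of the query. -/

namespace WordRAM

/-- The contents of the registers and of the memory. -/
structure State where
  reg : ℕ → ℤ
  mem : ℤ → ℤ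

namespace State

def setReg (s : State) (r : ℕ) (v : ℤ) : State :=
  { s with reg := Function.update s.reg r v }

def setMem (s : State) (a v : ℤ) : State :=
  { s with mem := Function.update s.mem a v }

/-- The contents of the `k` consecutive memory cells that start at address `a`. -/
def segment (s : State) (a : ℤ) (k : ℕ) : List ℤ :=
  (List.range k).map fun i => s.mem (a + (i : ℤ))

/-- The initial state on input `l`: the input occupies the memory cells `0, 1, 2, …`, register `0`
holds its length, and all the other cells and registers hold `0`. -/
def init (l : List ℤ) : State where
  reg := fun r => if r = 0 then (l.length : ℤ) else 0
  mem := fun a => if 0 ≤ a then l.getD a.toNat 0 else 0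

end State

/-- The arithmetic operations and comparisons of the machine. -/
inductive BinOp where
  | add | sub | mul | div | mod | lt | eq

/-- `div` and `mod` are integer division with remainder (remainder nonnegative, and
`a div 0 = 0`, `a mod 0 = a`); the comparisons return `1` or `0`. -/
def BinOp.eval : BinOp → ℤ → ℤ → ℤ
  | .add, a, b => a + b
  | .sub, a, b => a - b
  | .mul, a, b => a * b
  | .div, a, b => a / b
  | .mod, a, b => a % b
  | .lt, a, b => if a < b then 1 else 0
  | .eq, a, b => if a = b then 1 else 0

/-- Expressions: constants, registers, memory accesses and operations. -/
inductive Expr where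
  | const (z : ℤ)
  | reg (r : ℕ)
  | mem (a : Expr)
  | bin (op : BinOp) (e₁ e₂ : Expr)

namespace Expr

def eval (s : State) : Expr → ℤ
  | const z => z
  | reg r => s.reg r
  | mem a => s.mem (a.eval s)
  | bin op e₁ e₂ => op.eval (e₁.eval s) (e₂.eval s)

/-- Every value that occurs in the evaluation of the expression is a machine word. -/
def Fits (W : ℕ) (s : State) : Expr → Prop
  | const z => |z| ≤ (W : ℤ)
  | reg r => |s.reg r| ≤ (W : ℤ)
  | mem a => a.Fits W s ∧ |s.mem (a.eval s)| ≤ (W : ℤ)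
  | bin op e₁ e₂ =>
      e₁.Fits W s ∧ e₂.Fits W s ∧ |op.eval (e₁.eval s) (e₂.eval s)| ≤ (W : ℤ)

/-- The time needed to evaluate the expression: the number of its nodes. -/
def cost : Expr → ℕ
  | const _ => 1
  | reg _ => 1
  | mem a => a.cost + 1
  | bin _ e₁ e₂ => e₁.cost + e₂.cost + 1

end Expr

/-- Programs. `query r a k` asks the oracle about the list of `k` words stored in the memory from
address `a` on, and puts the answer (`1` for yes and `0` for no) into the register `r`. -/
inductive Program where
  | skip
  | assign (r : ℕ) (e : Expr)
  | store (a e : Expr)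
  | seq (p q : Program)
  | ite (e : Expr) (p q : Program)
  | loop (e : Expr) (p : Program)
  | query (r : ℕ) (a k : Expr)

/-- `Run B W p s s' T Q`: with words of absolute value at most `W` and an oracle for the problem
`B`, the program `p` started in the state `s` halts in the state `s'` after `T` units of time, and
`Q` is the list of the sizes of the instances of `B` that it submits to the oracle, in order.
A query that does not present an instance of `B` gets no answer: the program is stuck. -/
inductive Run (B : DecisionProblem) (W : ℕ) :
    Program → State → State → ℕ → List ℕ → Prop where
  | skip (s : State) : Run B W .skip s s 1 []
  | assign {s : State} {r : ℕ} {e : Expr} (he : e.Fits W s) :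
      Run B W (.assign r e) s (s.setReg r (e.eval s)) (e.cost + 1) []
  | store {s : State} {a e : Expr} (ha : a.Fits W s) (he : e.Fits W s) :
      Run B W (.store a e) s (s.setMem (a.eval s) (e.eval s)) (a.cost + e.cost + 1) []
  | seq {p q : Program} {s s₁ s₂ : State} {T₁ T₂ : ℕ} {Q₁ Q₂ : List ℕ}
      (h₁ : Run B W p s s₁ T₁ Q₁) (h₂ : Run B W q s₁ s₂ T₂ Q₂) :
      Run B W (.seq p q) s s₂ (T₁ + T₂) (Q₁ ++ Q₂)
  | iteTrue {e : Expr} {p q : Program} {s s' : State} {T : ℕ} {Q : List ℕ}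
      (he : e.Fits W s) (hc : e.eval s ≠ 0) (h : Run B W p s s' T Q) :
      Run B W (.ite e p q) s s' (e.cost + 1 + T) Q
  | iteFalse {e : Expr} {p q : Program} {s s' : State} {T : ℕ} {Q : List ℕ}
      (he : e.Fits W s) (hc : e.eval s = 0) (h : Run B W q s s' T Q) :
      Run B W (.ite e p q) s s' (e.cost + 1 + T) Q
  | loopDone {e : Expr} {p : Program} {s : State}
      (he : e.Fits W s) (hc : e.eval s = 0) :
      Run B W (.loop e p) s s (e.cost + 1) []
  | loopStep {e : Expr} {p : Program} {s s₁ s₂ : State} {T₁ T₂ : ℕ} {Q₁ Q₂ : List ℕ}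
      (he : e.Fits W s) (hc : e.eval s ≠ 0) (h₁ : Run B W p s s₁ T₁ Q₁)
      (h₂ : Run B W (.loop e p) s₁ s₂ T₂ Q₂) :
      Run B W (.loop e p) s s₂ (e.cost + 1 + T₁ + T₂) (Q₁ ++ Q₂)
  | query {r : ℕ} {a k : Expr} {s : State} {len : ℕ} {y : B.Inst} {v : ℤ}
      (ha : a.Fits W s) (hk : k.Fits W s) (hlen : k.eval s = (len : ℤ))
      (hy : B.Encodes y (s.segment (a.eval s) len))
      (hv : (B.Yes y ∧ v = 1) ∨ (¬ B.Yes y ∧ v = 0)) :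
      Run B W (.query r a k) s (s.setReg r v) (a.cost + k.cost + len + 1) [B.size y]

/-- The machine is deterministic. -/
theorem Run.deterministic {B : DecisionProblem} {W : ℕ} {p : Program} {s s₁ : State} {T₁ : ℕ}
    {Q₁ : List ℕ} (h₁ : Run B W p s s₁ T₁ Q₁) :
    ∀ {s₂ : State} {T₂ : ℕ} {Q₂ : List ℕ}, Run B W p s s₂ T₂ Q₂ →
      s₁ = s₂ ∧ T₁ = T₂ ∧ Q₁ = Q₂ := by
  induction h₁ with
  | skip s => intro _ _ _ h; cases h; simp
  | assign he => intro _ _ _ h; cases h; simp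
  | store ha he => intro _ _ _ h; cases h; simp
  | seq _ _ ih₁ ih₂ =>
    intro _ _ _ h
    cases h with
    | seq g₁ g₂ =>
      obtain ⟨rfl, rfl, rfl⟩ := ih₁ g₁
      obtain ⟨rfl, rfl, rfl⟩ := ih₂ g₂
      simp
  | iteTrue he hc _ ih =>
    intro _ _ _ h
    cases h with
    | iteTrue _ _ g => obtain ⟨rfl, rfl, rfl⟩ := ih g; simp
    | iteFalse _ hc' g => exact absurd hc' hc
  | iteFalse he hc _ ih =>
    intro _ _ _ h
    cases h with
    | iteTrue _ hc' g => exact absurd hc hc'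
    | iteFalse _ _ g => obtain ⟨rfl, rfl, rfl⟩ := ih g; simp
  | loopDone he hc =>
    intro _ _ _ h
    cases h with
    | loopDone _ _ => simp
    | loopStep _ hc' _ _ => exact absurd hc hc'
  | loopStep he hc _ _ ih₁ ih₂ =>
    intro _ _ _ h
    cases h with
    | loopDone _ hc' => exact absurd hc' hc
    | loopStep _ _ g₁ g₂ =>
      obtain ⟨rfl, rfl, rfl⟩ := ih₁ g₁
      obtain ⟨rfl, rfl, rfl⟩ := ih₂ g₂
      simp
  | query ha hk hlen hy hv =>
    intro _ _ _ h
    cases h with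
    | query _ _ hlen' hy' hv' =>
      have e := hlen.symm.trans hlen'
      norm_cast at e
      subst e
      obtain rfl := B.encodes_unique hy hy'
      rcases hv with ⟨a, rfl⟩ | ⟨a, rfl⟩ <;> rcases hv' with ⟨b, rfl⟩ | ⟨b, rfl⟩ <;>
        first | exact absurd a b | exact absurd b a | simp

end WordRAM

/-! ### Subquadratic reductions -/

/-- There is a subquadratic reduction from `A` to `B`: one deterministic program with an oracle for
`B`, on the word RAM with words of `O(log m)` bits on instances of size `m` (integers of absolute
value at most `(m + 2) ^ c`), such that for every `ε > 0` there is `δ > 0` for which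
* the program halts on every instance of `A`, with the correct answer in register `0`;
* it takes time `O(m ^ (2 - δ))` on instances of size `m`;
* the sizes `mᵢ` of its oracle calls satisfy `∑ᵢ mᵢ ^ (2 - ε) ≤ m ^ (2 - δ)` on all instances of
  sufficiently large size `m`. -/
def SubquadraticReduction (A B : DecisionProblem) : Prop :=
  ∃ (P : WordRAM.Program) (c : ℕ), ∀ ε : ℝ, 0 < ε → ∃ δ : ℝ, 0 < δ ∧ ∃ (C : ℝ) (m₀ : ℕ),
    ∀ (x : A.Inst) (l : List ℤ), A.Encodes x l →
      ∃ (s : WordRAM.State) (T : ℕ) (Q : List ℕ),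
        WordRAM.Run B ((A.size x + 2) ^ c) P (WordRAM.State.init l) s T Q ∧
        (A.Yes x → s.reg 0 = 1) ∧ (¬ A.Yes x → s.reg 0 = 0) ∧
        (m₀ ≤ A.size x →
          (T : ℝ) ≤ C * (A.size x : ℝ) ^ (2 - δ) ∧
          (Q.map fun k : ℕ => (k : ℝ) ^ (2 - ε)).sum ≤ (A.size x : ℝ) ^ (2 - δ))

infix:50 " ≤₂ " => SubquadraticReduction

/-! ### Linear degeneracy testing -/

/-- The list `l` enumerates the elements of the finite set `X`, in any order and without
repetition. -/
def Enumerates (l : List ℤ) (X : Finset ℤ) : Prop :=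
  l.Nodup ∧ ∀ x, x ∈ l ↔ x ∈ X

theorem Enumerates.unique {l : List ℤ} {X Y : Finset ℤ} (hX : Enumerates l X)
    (hY : Enumerates l Y) : X = Y :=
  Finset.ext fun x => (hX.2 x).symm.trans (hY.2 x)

theorem Enumerates.length_eq {l : List ℤ} {X : Finset ℤ} (h : Enumerates l X) :
    l.length = X.card := by
  have e : l.toFinset = X := Finset.ext fun x => by rw [List.mem_toFinset]; exact h.2 x
  rw [← e, List.toFinset_card_of_nodup h.1]

/-- A set of `n` integers from `{-n³, …, n³}`. -/
structure OnePartiteInst where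
  X : Finset ℤ
  bound : ∀ x ∈ X, |x| ≤ (X.card : ℤ) ^ 3

/-- Three sets of `n` integers each from `{-n³, …, n³}`. -/
structure ThreePartiteInst where
  n : ℕ
  A : Fin 3 → Finset ℤ
  card_eq : ∀ i, (A i).card = n
  bound : ∀ i, ∀ x ∈ A i, |x| ≤ (n : ℤ) ^ 3

/-- The 1-partite problem `3-LDT(1, α, t)`. -/
def LDT1 (α : Fin 3 → ℤ) (t : ℤ) : DecisionProblem where
  Inst := OnePartiteInst
  size I := I.X.card
  Yes I := ∃ x : Fin 3 → ℤ, Function.Injective x ∧ (∀ i, x i ∈ I.X) ∧ ∑ i, α i * x i = t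
  Encodes I l := Enumerates l I.X
  encodes_unique := by
    rintro ⟨X, _⟩ ⟨Y, _⟩ l hX hY
    obtain rfl : X = Y := hX.unique hY
    rfl

/-- The 3-partite problem `3-LDT(3, α, t)`. The three sets are listed one after the other. -/
def LDT3 (α : Fin 3 → ℤ) (t : ℤ) : DecisionProblem where
  Inst := ThreePartiteInst
  size I := I.n
  Yes I := ∃ x : Fin 3 → ℤ, (∀ i, x i ∈ I.A i) ∧ ∑ i, α i * x i = t
  Encodes I l := ∃ L : Fin 3 → List ℤ, (∀ i, Enumerates (L i) (I.A i)) ∧ l = L 0 ++ L 1 ++ L 2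
  encodes_unique := by
    rintro ⟨n, A, hA, _⟩ ⟨k, A', hA', _⟩ l ⟨L, hL, rfl⟩ ⟨L', hL', h⟩
    have e (i) : (L i).length = n := (hL i).length_eq.trans (hA i)
    have e' (i) : (L' i).length = k := (hL' i).length_eq.trans (hA' i)
    have hlen := congrArg List.length h
    simp only [List.length_append, e, e'] at hlen
    obtain rfl : n = k := by omega
    obtain ⟨h01, h2⟩ := List.append_inj h (by simp [e, e'])
    obtain ⟨h0, h1⟩ := List.append_inj h01 (by simp [e, e'])
    have hLL : L = L' := by
      funext i
      fin_cases i <;> assumption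
    subst hLL
    obtain rfl : A = A' := funext fun i => (hL i).unique (hL' i)
    rfl

/-! ### Solution-free colour classes -/

theorem eq_zero_of_mul_add_eq_zero {L x y : ℤ} (h : L * x + y = 0) (hy : |y| < L) :
    x = 0 ∧ y = 0 := by
  have hx : x = 0 := by
    by_contra hx
    have h1 : 1 ≤ |x| := Int.one_le_abs hx
    have h2 : |y| = L * |x| := by
      rw [show y = -(L * x) by linarith, abs_neg, abs_mul, abs_of_pos ((abs_nonneg y).trans_lt hy)]
    nlinarith [abs_nonneg y]
  subst hx
  exact ⟨rfl, by simpa using h⟩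

/-- The sum of the absolute values of the coefficients. -/
def coeffNorm (α : Fin 3 → ℤ) : ℤ := ∑ i, |α i|

theorem abs_sum_le_coeffNorm_mul (α x : Fin 3 → ℤ) {r : ℤ} (hx : ∀ i, |x i| ≤ r) :
    |∑ i, α i * x i| ≤ coeffNorm α * r := by
  rw [coeffNorm, Finset.sum_mul]
  refine (Finset.abs_sum_le_sum_abs _ _).trans (Finset.sum_le_sum fun i _ => ?_)
  rw [abs_mul]
  exact mul_le_mul_of_nonneg_left (hx i) (abs_nonneg _)

theorem three_le_coeffNorm {α : Fin 3 → ℤ} (hα : ∀ i, α i ≠ 0) : 3 ≤ coeffNorm α := by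
  have h := fun i => Int.one_le_abs (hα i)
  rw [coeffNorm, Fin.sum_univ_three]
  linarith [h 0, h 1, h 2]

/-- A point on a strictly convex surface is not a proper affine combination of two others. -/
theorem neg_mul_sum_sq {α x : Fin 3 → ℤ} (h₀ : ∑ i, α i = 0) (h₁ : ∑ i, α i * x i = 0) :
    -α 2 * ∑ i, α i * x i ^ 2 = α 0 * α 1 * (x 0 - x 1) ^ 2 := by
  simp only [Fin.sum_univ_three] at *
  have h2 : α 2 = -(α 0 + α 1) := by linarith
  rw [h2] at h₁ ⊢
  linear_combination (α 0 * x 0 + α 1 * x 1 + (α 0 + α 1) * x 2) * h₁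

section Colour

variable (S g v : ℤ)

/-- Dividing `i` times by the base `S * g`. -/
def quo : ℕ → ℤ
  | 0 => v
  | i + 1 => quo i / (S * g)

/-- The code of the high parts of the lowest `i` digits. -/
def hiCode : ℕ → ℤ
  | 0 => 0
  | i + 1 => hiCode i * S + quo S g v i % (S * g) / g

/-- The sum of the squares of the low parts of the lowest `i` digits. -/
def loNorm : ℕ → ℤ
  | 0 => 0
  | i + 1 => loNorm i + quo S g v i % (S * g) % g * (quo S g v i % (S * g) % g)

/-- The colour of a number with `d` digits in base `S * g`. -/
def colour (d : ℕ) : ℤ := hiCode S g v d * (d * g * g + 1) + loNorm S g v d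

variable {S g v}

theorem quo_nonneg (hS : 0 < S) (hg : 0 < g) (hv : 0 ≤ v) (i : ℕ) : 0 ≤ quo S g v i := by
  induction i with
  | zero => exact hv
  | succ i ih => exact Int.ediv_nonneg ih (mul_pos hS hg).le

theorem quo_mul_pow_le (hS : 0 < S) (hg : 0 < g) (i : ℕ) : quo S g v i * (S * g) ^ i ≤ v := by
  induction i with
  | zero => simp [quo]
  | succ i ih =>
    have h := Int.ediv_mul_le (quo S g v i) (mul_pos hS hg).ne'
    calc quo S g v (i + 1) * (S * g) ^ (i + 1)
        = quo S g v i / (S * g) * (S * g) * (S * g) ^ i := by rw [quo]; ring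
      _ ≤ quo S g v i * (S * g) ^ i := mul_le_mul_of_nonneg_right h (pow_pos (mul_pos hS hg) _).le
      _ ≤ v := ih

theorem quo_le (hS : 0 < S) (hg : 0 < g) (hv : 0 ≤ v) (i : ℕ) : quo S g v i ≤ v := by
  have h := quo_mul_pow_le (v := v) hS hg i
  have h1 : 1 ≤ (S * g) ^ i := one_le_pow₀ (by nlinarith)
  nlinarith [quo_nonneg hS hg hv i]

theorem quo_eq_zero (hS : 0 < S) (hg : 0 < g) (hv : 0 ≤ v) {d : ℕ} (hd : v < (S * g) ^ d) :
    quo S g v d = 0 := by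
  have h := quo_mul_pow_le (v := v) hS hg d
  have h1 : 1 ≤ (S * g) ^ d := one_le_pow₀ (by nlinarith)
  have := quo_nonneg hS hg hv d
  by_contra h2
  have : 1 ≤ quo S g v d := by omega
  nlinarith

theorem hiDigit_nonneg (hS : 0 < S) (hg : 0 < g) (x : ℤ) : 0 ≤ x % (S * g) / g :=
  Int.ediv_nonneg (Int.emod_nonneg _ (mul_pos hS hg).ne') hg.le

theorem hiDigit_lt (hS : 0 < S) (hg : 0 < g) (x : ℤ) : x % (S * g) / g < S :=
  Int.ediv_lt_of_lt_mul hg (Int.emod_lt_of_pos _ (mul_pos hS hg))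

theorem digit_decomposition (x : ℤ) :
    x = S * g * (x / (S * g)) + g * (x % (S * g) / g) + x % (S * g) % g := by
  have h₁ := Int.mul_ediv_add_emod x (S * g)
  have h₂ := Int.mul_ediv_add_emod (x % (S * g)) g
  linarith

theorem hiCode_nonneg (hS : 0 < S) (hg : 0 < g) (i : ℕ) : 0 ≤ hiCode S g v i := by
  induction i with
  | zero => simp [hiCode]
  | succ i ih => exact add_nonneg (mul_nonneg ih hS.le) (hiDigit_nonneg hS hg _)

theorem hiCode_lt (hS : 0 < S) (hg : 0 < g) (i : ℕ) : hiCode S g v i < S ^ i := by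
  induction i with
  | zero => simp [hiCode]
  | succ i ih =>
    have := hiDigit_lt hS hg (quo S g v i)
    rw [hiCode, pow_succ]
    nlinarith

theorem loNorm_nonneg (i : ℕ) : 0 ≤ loNorm S g v i := by
  induction i with
  | zero => simp [loNorm]
  | succ i ih => exact add_nonneg ih (mul_self_nonneg _)

theorem loNorm_le (hg : 0 < g) (i : ℕ) : loNorm S g v i ≤ i * g * g := by
  induction i with
  | zero => simp [loNorm]
  | succ i ih =>
    have h₁ := Int.emod_lt_of_pos (quo S g v i % (S * g)) hg
    have h₂ := Int.emod_nonneg (quo S g v i % (S * g)) hg.ne'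
    rw [loNorm]
    push_cast
    nlinarith

theorem colour_nonneg (hS : 0 < S) (hg : 0 < g) (d : ℕ) : 0 ≤ colour S g v d :=
  add_nonneg (mul_nonneg (hiCode_nonneg hS hg d) (by positivity)) (loNorm_nonneg d)

theorem colour_lt (hS : 0 < S) (hg : 0 < g) (d : ℕ) :
    colour S g v d < S ^ d * (d * g * g + 1) := by
  have h₁ := hiCode_lt (v := v) hS hg d
  have h₂ := loNorm_le (S := S) (v := v) hg d
  have h₃ : 0 ≤ (d : ℤ) * g * g := by positivity
  rw [colour]
  nlinarith

theorem eq_of_mul_add_eq {Q a b x y : ℤ} (h : a * Q + x = b * Q + y) (hx : 0 ≤ x) (hx' : x < Q)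
    (hy : 0 ≤ y) (hy' : y < Q) : a = b ∧ x = y := by
  have := eq_zero_of_mul_add_eq_zero (L := Q) (x := a - b) (y := x - y) (by linarith)
    (by rw [abs_lt]; constructor <;> linarith)
  omega

/-- The norm is at most `d * g * g`, so it is a legitimate last digit for the radix `d * g * g + 1`
in `colour`. -/
theorem hiCode_loNorm_eq {w : ℤ} {d : ℕ} (hg : 0 < g)
    (h : colour S g v d = colour S g w d) :
    hiCode S g v d = hiCode S g w d ∧ loNorm S g v d = loNorm S g w d :=
  eq_of_mul_add_eq h (loNorm_nonneg d) (Int.lt_add_one_of_le (loNorm_le hg d))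
    (loNorm_nonneg d) (Int.lt_add_one_of_le (loNorm_le hg d))

/-- `hiCode` is a numeral in base `S` whose digits are all below `S`; its digits are peeled off from
the last one. -/
theorem hiDigit_eq_of_hiCode_eq {w : ℤ} (hS : 0 < S) (hg : 0 < g) {d : ℕ}
    (h : hiCode S g v d = hiCode S g w d) {i : ℕ} (hi : i < d) :
    quo S g v i % (S * g) / g = quo S g w i % (S * g) / g := by
  induction d with
  | zero => omega
  | succ d ih =>
    obtain ⟨h₁, h₂⟩ := eq_of_mul_add_eq h (hiDigit_nonneg hS hg _) (hiDigit_lt hS hg _)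
      (hiDigit_nonneg hS hg _) (hiDigit_lt hS hg _)
    rcases Nat.lt_succ_iff_lt_or_eq.1 hi with hi | rfl
    · exact ih h₁ hi
    · exact h₂

theorem eq_of_digits_eq {w : ℤ} {d : ℕ} (h : quo S g v d = quo S g w d)
    (hhi : ∀ i < d, quo S g v i % (S * g) / g = quo S g w i % (S * g) / g)
    (hlo : ∀ i < d, quo S g v i % (S * g) % g = quo S g w i % (S * g) % g) : v = w := by
  induction d with
  | zero => exact h
  | succ d ih =>
    refine ih ?_ (fun i hi => hhi i (by omega)) fun i hi => hlo i (by omega)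
    have e : quo S g v d / (S * g) = quo S g w d / (S * g) := h
    rw [digit_decomposition (S := S) (g := g) (quo S g v d), e, hhi d (by omega), hlo d (by omega),
      ← digit_decomposition]

end Colour

/-- Colour classes contain no nontrivial solutions of a translation invariant equation. -/
theorem eq_of_colour_eq {α : Fin 3 → ℤ} (hα : ∀ i, α i ≠ 0) (h₀ : ∑ i, α i = 0) {g p : ℤ}
    (hg : 0 < g) {d : ℕ} {v : Fin 3 → ℤ} (hv : ∀ i, 0 ≤ v i)
    (hd : ∀ i, v i < (coeffNorm α * g) ^ d) (hc : ∀ i, colour (coeffNorm α) g (v i) d = p)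
    (h : ∑ i, α i * v i = 0) : v 0 = v 1 := by
  have hS : 0 < coeffNorm α := by linarith [three_le_coeffNorm hα]
  set S := coeffNorm α with hSdef
  have hcol (i j) := hiCode_loNorm_eq hg ((hc i).trans (hc j).symm)
  have hhi (i j : Fin 3) (a : ℕ) (ha : a < d) :=
    hiDigit_eq_of_hiCode_eq hS hg (hcol i j).1 ha
  let lo (a : ℕ) (i : Fin 3) : ℤ := quo S g (v i) a % (S * g) % g
  -- No carries: if the equation holds for the `a`-th quotients, it holds for the next quotients and
  -- for the low parts of the `a`-th digits separately. The low parts contribute at most `S * (g -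
  -- 1)` in absolute value, less than the base `S * g`.
  have step (a : ℕ) (ha : a < d) (hz : ∑ i, α i * quo S g (v i) a = 0) :
      ∑ i, α i * quo S g (v i) (a + 1) = 0 ∧ ∑ i, α i * lo a i = 0 := by
    have hb : |∑ i, α i * lo a i| < S * g := by
      have := abs_sum_le_coeffNorm_mul α (lo a) (r := g - 1) fun i => by
        have h₁ := Int.emod_lt_of_pos (quo S g (v i) a % (S * g)) hg
        have h₂ := Int.emod_nonneg (quo S g (v i) a % (S * g)) hg.ne'
        rw [abs_of_nonneg h₂]
        exact Int.le_sub_one_of_lt h₁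
      rw [← hSdef] at this
      nlinarith
    refine eq_zero_of_mul_add_eq_zero ?_ hb
    have e (i) := digit_decomposition (S := S) (g := g) (quo S g (v i) a)
    have h01 := hhi 0 2 a ha
    have h12 := hhi 1 2 a ha
    simp only [Fin.sum_univ_three, quo, lo] at *
    -- The high parts agree, so they contribute a multiple of `∑ i, α i = 0`.
    rw [e 0, e 1, e 2, h01, h12] at hz
    linear_combination hz - g * (quo S g (v 2) a % (S * g) / g) * h₀
  have hquo : ∀ a ≤ d, ∑ i, α i * quo S g (v i) a = 0 := by
    intro a
    induction a with
    | zero => exact fun _ => h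
    | succ a ih => exact fun ha => (step a ha (ih (by omega))).1
  have hlo (a) (ha : a < d) := (step a ha (hquo a ha.le)).2
  have hnorm : ∀ a ≤ d, -α 2 * ∑ i, α i * loNorm S g (v i) a
      = α 0 * α 1 * ∑ c ∈ Finset.range a, (lo c 0 - lo c 1) ^ 2 := by
    intro a
    induction a with
    | zero => simp [loNorm]
    | succ a ih =>
      intro ha
      rw [Finset.sum_range_succ, mul_add, ← ih (by omega), ← neg_mul_sum_sq h₀ (hlo a ha)]
      simp only [Fin.sum_univ_three, loNorm, lo]
      ring
  -- The three norms are equal, so the left side of `hnorm` is a multiple of `∑ i, α i = 0`, and the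
  -- factor `α 0 * α 1` is nonzero.
  have hzero : ∑ c ∈ Finset.range d, (lo c 0 - lo c 1) ^ 2 = 0 := by
    have e := hnorm d le_rfl
    rw [Finset.sum_congr rfl fun i _ => by rw [(hcol i 0).2], ← Finset.sum_mul, h₀] at e
    simpa [hα] using e
  rw [Finset.sum_eq_zero_iff_of_nonneg fun _ _ => sq_nonneg _] at hzero
  refine eq_of_digits_eq (S := S) (g := g) (d := d) ?_ (hhi 0 1) fun a ha => ?_
  · rw [quo_eq_zero hS hg (hv 0) (hd 0), quo_eq_zero hS hg (hv 1) (hd 1)]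
  · have := hzero a (Finset.mem_range.2 ha)
    exact sub_eq_zero.1 (pow_eq_zero_iff two_ne_zero |>.1 this)

/-! ### Padding elements -/

/-- The number `L₁ u + L₂ v + u² + v²`, where `u` and `v` are quotient and remainder of `a`. -/
def padValue (K L₁ L₂ a : ℤ) : ℤ :=
  L₁ * (a / K) + L₂ * (a % K) + (a / K * (a / K) + a % K * (a % K))

section Padding

variable {S K U : ℤ}

theorem pad_norm_bound (hK : 0 < K) (hKU : K ≤ U) {a : ℤ} (ha : 0 ≤ a) (haU : a < K * U) :
    (0 ≤ a / K ∧ a / K < U) ∧ (0 ≤ a % K ∧ a % K < K) ∧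
      0 ≤ a / K * (a / K) + a % K * (a % K) ∧
      a / K * (a / K) + a % K * (a % K) < 2 * U * U := by
  have h₁ : 0 ≤ a / K := Int.ediv_nonneg ha hK.le
  have h₂ : a / K < U := Int.ediv_lt_of_lt_mul hK (by linarith)
  have h₃ := Int.emod_nonneg a hK.ne'
  have h₄ := Int.emod_lt_of_pos a hK
  refine ⟨⟨h₁, h₂⟩, ⟨h₃, h₄⟩, by positivity, ?_⟩
  nlinarith

theorem padValue_nonneg (hS : 0 ≤ S) (hK : 0 < K) (hKU : K ≤ U) {a : ℤ} (ha : 0 ≤ a)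
    (haU : a < K * U) : 0 ≤ padValue K (S * K * (2 * S * U * U)) (2 * S * U * U) a := by
  obtain ⟨⟨h₁, h₂⟩, ⟨h₃, h₄⟩, h₅, h₆⟩ := pad_norm_bound hK hKU ha haU
  have : 0 < U := by linarith
  exact add_nonneg (by positivity) h₅

theorem padValue_lt (hS : 3 ≤ S) (hK : 0 < K) (hKU : K ≤ U) {a : ℤ} (ha : 0 ≤ a)
    (haU : a < K * U) :
    padValue K (S * K * (2 * S * U * U)) (2 * S * U * U) a < S * K * (2 * S * U * U) * U := by
  obtain ⟨⟨h₁, h₂⟩, ⟨h₃, h₄⟩, h₅, h₆⟩ := pad_norm_bound hK hKU ha haU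
  have hU : 0 < U := by linarith
  have hUU : 0 < U * U := mul_pos hU hU
  rw [padValue]
  set L := 2 * S * U * U with hL
  have hL' : 2 * U * U < L := by nlinarith
  have hL0 : 0 < L := by nlinarith
  have e₁ : L * (a % K) + (a / K * (a / K) + a % K * (a % K)) < L * K := by nlinarith
  have e₂ : L * K ≤ S * K * L := by nlinarith [mul_pos hL0 hK]
  have e₃ : S * K * L * (a / K) + S * K * L ≤ S * K * L * U := by
    have : 0 ≤ S * K * L := by positivity
    nlinarith
  linarith

/-- A linear equation between padding elements can be read off coordinate by coordinate. -/
theorem sum_coordinates_eq_zero (β : Fin 3 → ℤ) (hβ : coeffNorm β ≤ S) (hS : 3 ≤ S) (hK : 0 < K)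
    (hKU : K ≤ U) {a : Fin 3 → ℤ} (ha : ∀ i, 0 ≤ a i) (haU : ∀ i, a i < K * U)
    (h : ∑ i, β i * padValue K (S * K * (2 * S * U * U)) (2 * S * U * U) (a i) = 0) :
    ∑ i, β i * (a i / K) = 0 ∧ ∑ i, β i * (a i % K) = 0 ∧
      ∑ i, β i * (a i / K * (a i / K) + a i % K * (a i % K)) = 0 := by
  have hb (i) := pad_norm_bound hK hKU (ha i) (haU i)
  have hU : 0 < U := by linarith
  have hUU : 0 < U * U := mul_pos hU hU
  set L := 2 * S * U * U with hL
  have hβ0 : 0 ≤ coeffNorm β := Finset.sum_nonneg fun _ _ => abs_nonneg _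
  have hlow : |∑ i, β i * (a i / K * (a i / K) + a i % K * (a i % K))| < L := by
    refine (abs_sum_le_coeffNorm_mul β _ (r := 2 * U * U - 1) fun i => ?_).trans_lt ?_
    · rw [abs_of_nonneg (hb i).2.2.1]; linarith [(hb i).2.2.2]
    · nlinarith
  have hmid : |∑ i, β i * (a i % K)| ≤ S * (K - 1) := by
    refine (abs_sum_le_coeffNorm_mul β _ (r := K - 1) fun i => ?_).trans ?_
    · rw [abs_of_nonneg (hb i).2.1.1]; linarith [(hb i).2.1.2]
    · nlinarith
  have hL0 : 0 < L := (abs_nonneg _).trans_lt hlow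
  have h₁ : S * K * L * (∑ i, β i * (a i / K)) + (L * (∑ i, β i * (a i % K)) +
      ∑ i, β i * (a i / K * (a i / K) + a i % K * (a i % K))) = 0 := by
    rw [← h]
    simp only [Fin.sum_univ_three, padValue]
    ring
  -- The weights `S * K * L`, `L`, `1` form a three-level positional system: the norm part is below
  -- `L`, and together with `L` times the middle sum it stays below `L * S * (K - 1) + L ≤ S * K *
  -- L`.
  obtain ⟨e₁, e₂⟩ := eq_zero_of_mul_add_eq_zero h₁ (by
    refine (abs_add_le _ _).trans_lt ?_
    rw [abs_mul, abs_of_pos hL0]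
    nlinarith)
  obtain ⟨e₃, e₄⟩ := eq_zero_of_mul_add_eq_zero e₂ hlow
  exact ⟨e₁, e₃, e₄⟩

theorem padValue_injOn (hS : 3 ≤ S) (hK : 0 < K) (hKU : K ≤ U) {a b : ℤ} (ha : 0 ≤ a)
    (haU : a < K * U) (hb : 0 ≤ b) (hbU : b < K * U)
    (h : padValue K (S * K * (2 * S * U * U)) (2 * S * U * U) a
      = padValue K (S * K * (2 * S * U * U)) (2 * S * U * U) b) : a = b := by
  -- Injectivity is the equation `1 * a - 1 * b + 0 * a = 0`, whose coefficient norm is `2 ≤ S`; the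
  -- third point is a dummy.
  obtain ⟨h₁, h₂, -⟩ := sum_coordinates_eq_zero (S := S) ![1, -1, 0]
    (by simp [coeffNorm, Fin.sum_univ_three]; linarith) hS hK hKU (a := ![a, b, a])
    (by intro i; fin_cases i <;> assumption) (by intro i; fin_cases i <;> assumption)
    (by simp [Fin.sum_univ_three, h])
  simp [Fin.sum_univ_three] at h₁ h₂
  rw [← Int.mul_ediv_add_emod a K, ← Int.mul_ediv_add_emod b K, show a / K = b / K by linarith,
    show a % K = b % K by linarith]

/-- The padding elements contain no nontrivial solutions of a translation invariant equation. -/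
theorem eq_of_sum_padValue_eq_zero {α : Fin 3 → ℤ} (hα : ∀ i, α i ≠ 0) (h₀ : ∑ i, α i = 0)
    (hK : 0 < K) (hKU : K ≤ U) {a : Fin 3 → ℤ} (ha : ∀ i, 0 ≤ a i) (haU : ∀ i, a i < K * U)
    (h : ∑ i, α i * padValue K (coeffNorm α * K * (2 * coeffNorm α * U * U))
      (2 * coeffNorm α * U * U) (a i) = 0) : a 0 = a 1 := by
  obtain ⟨h₁, h₂, h₃⟩ :=
    sum_coordinates_eq_zero α le_rfl (three_le_coeffNorm hα) hK hKU ha haU h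
  have e₁ := neg_mul_sum_sq h₀ h₁
  have e₂ := neg_mul_sum_sq h₀ h₂
  -- The convexity identities in the two coordinates add up, and the norm coordinate says that the
  -- total vanishes.
  have e : α 0 * α 1 * ((a 0 / K - a 1 / K) ^ 2 + (a 0 % K - a 1 % K) ^ 2) = 0 := by
    rw [mul_add, ← e₁, ← e₂]
    simp only [Fin.sum_univ_three] at h₃ ⊢
    linear_combination -α 2 * h₃
  have e' := (mul_eq_zero.1 e).resolve_left (mul_ne_zero (hα 0) (hα 1))
  have f₁ : a 0 / K - a 1 / K = 0 := by nlinarith [sq_nonneg (a 0 % K - a 1 % K)]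
  have f₂ : a 0 % K - a 1 % K = 0 := by nlinarith [sq_nonneg (a 0 / K - a 1 / K)]
  rw [← Int.mul_ediv_add_emod (a 0) K, ← Int.mul_ediv_add_emod (a 1) K,
    show a 0 / K = a 1 / K by linarith, show a 0 % K = a 1 % K by linarith]

end Padding

/-! ### Generic offsets -/

theorem eq_zero_of_quadratic_eq_zero {H a b c : ℤ} (ha : |a| < H) (hb : |b| < H)
    (h : a + b * H + c * H ^ 2 = 0) : a = 0 ∧ b = 0 ∧ c = 0 := by
  obtain ⟨h₁, h₂⟩ := eq_zero_of_mul_add_eq_zero (L := H) (x := b + c * H) (y := a)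
    (by linarith) ha
  obtain ⟨h₃, h₄⟩ := eq_zero_of_mul_add_eq_zero (L := H) (x := c) (y := b) (by linarith) hb
  exact ⟨h₂, h₄, h₃⟩

/-- There are offsets for which a solution of the shifted equation reveals, up to a symmetry of the
equation, which offset was used where. -/
theorem exists_generic_offsets (α : Fin 3 → ℤ) (hα : ∀ i, α i ≠ 0) :
    ∃ γ : Fin 4 → ℤ, Function.Injective γ ∧ ∑ i : Fin 3, α i * γ i.castSucc = 0 ∧
      ∀ σ : Fin 3 → Fin 4, ∑ i, α i * γ (σ i) = 0 →
        (∑ i, α i = 0 ∧ ∃ j, ∀ i, σ i = j) ∨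
        ∃ π : Equiv.Perm (Fin 3), (∀ i, σ i = (π i).castSucc) ∧ ∀ i, α (π i) = α i := by
  have h3 := three_le_coeffNorm hα
  set S := coeffNorm α with hS
  set H := 2 * S * S + 1 with hH
  have hαS (i) : |α i| ≤ S := Finset.single_le_sum (f := fun i => |α i|)
    (fun i _ => abs_nonneg (α i)) (Finset.mem_univ i)
  have hSS : S < H := by nlinarith
  -- `H` plays the role of an indeterminate: every coefficient that occurs below `H ^ 2` is smaller
  -- than `H`. The third offset is chosen to cancel the first two in `∑ α i * γ i`; the `H ^ 2` of
  -- the fourth keeps the padding apart.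
  let γ : Fin 4 → ℤ := ![α 2, α 2 * H, -(α 0 + α 1 * H), α 2 * H ^ 2]
  have hadd (i j) : |α i + α j| < H := by
    have := abs_add_le (α i) (α j)
    nlinarith [hαS i, hαS j]
  have h2 (z i) (hz : |z| < H) : z + α i * H ≠ 0 := fun e => by
    obtain ⟨-, h, -⟩ := eq_zero_of_quadratic_eq_zero (c := 0) hz ((hαS i).trans_lt hSS)
      (by linarith)
    exact hα i h
  have h5 (z y i) (hz : |z| < H) (hy : |y| < H) : z + y * H + α i * H ^ 2 ≠ 0 := fun e => by
    obtain ⟨-, -, h⟩ := eq_zero_of_quadratic_eq_zero hz hy e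
    exact hα i h
  have hneg (i) : |-α i| < H := by rw [abs_neg]; exact (hαS i).trans_lt hSS
  have hpos (i) : |α i| < H := (hαS i).trans_lt hSS
  have h0 : |(0 : ℤ)| < H := by simp; linarith
  refine ⟨γ, ?_, ?_, ?_⟩
  · have hlt : ∀ i j : Fin 4, i < j → γ i ≠ γ j := by
      intro i j hij e
      fin_cases i <;> fin_cases j <;> simp at hij <;> simp [γ] at e
      · exact h2 _ 2 (hneg 2) (by linarith)
      · exact h2 _ 1 (hadd 0 2) (by linarith)
      · exact h5 _ 0 2 (hneg 2) h0 (by linarith)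
      · have := eq_zero_of_quadratic_eq_zero (c := 0) (a := α 0) (b := α 1 + α 2) (hpos 0) (hadd 1 2)
          (by linarith)
        exact hα 0 this.1
      · rcases e with e | e
        · nlinarith
        · exact hα 2 e
      · exact h5 _ _ 2 (hpos 0) (hpos 1) (by linarith)
    intro i j e
    by_contra hne
    rcases lt_or_gt_of_ne hne with h | h
    · exact hlt _ _ h e
    · exact hlt _ _ h e.symm
  · simp [Fin.sum_univ_three, γ, Fin.castSucc]
    ring
  intro σ hσ
  -- The total coefficient that falls on offset `j`. Comparing powers of `H` shows that `m 3 = 0`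
  -- and that `(m 0, m 1, m 2)` is proportional to `α`.
  let m (j : Fin 4) : ℤ := ∑ i, if σ i = j then α i else 0
  have hmS (j) : |m j| ≤ S := (Finset.abs_sum_le_sum_abs _ _).trans
    (Finset.sum_le_sum fun i _ => by split_ifs <;> simp)
  have hsum : ∑ j, m j * γ j = 0 := by
    rw [← hσ]
    simp only [m, Finset.sum_mul]
    rw [Finset.sum_comm]
    simp
  have hsmall (i j k l) : |m i * α j - m k * α l| < H := by
    refine (abs_sub _ _).trans_lt ?_
    rw [abs_mul, abs_mul]
    nlinarith [hmS i, hmS k, hαS j, hαS l, abs_nonneg (m i), abs_nonneg (m k), abs_nonneg (α j),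
      abs_nonneg (α l)]
  obtain ⟨e0, e1, e3⟩ := eq_zero_of_quadratic_eq_zero (c := m 3 * α 2) (hsmall 0 2 2 0)
    (hsmall 1 2 2 1) (by
      simp only [Fin.sum_univ_four, γ] at hsum
      simp at hsum
      linear_combination hsum)
  have hm3 : m 3 = 0 := (mul_eq_zero.1 e3).resolve_right (hα 2)
  by_cases hm2 : m 2 = 0
  · have hm0 : m 0 = 0 := (mul_eq_zero.1 (by simpa [hm2] using e0)).resolve_right (hα 2)
    have hm1 : m 1 = 0 := (mul_eq_zero.1 (by simpa [hm2] using e1)).resolve_right (hα 2)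
    have hm : ∀ j, m j = 0 := by intro j; fin_cases j <;> assumption
    left
    have a0 := hm (σ 0)
    have a1 := hm (σ 1)
    have a2 := hm (σ 2)
    simp only [m, Fin.sum_univ_three] at a0 a1 a2
    have n0 := hα 0
    have n1 := hα 1
    have n2 := hα 2
    -- Every fibre of `σ` that occurs has coefficient sum zero. A single nonzero coefficient does
    -- not sum to zero, so each such fibre has at least two of the three indices, and there is only
    -- one fibre.
    have : σ 1 = σ 0 ∧ σ 2 = σ 0 := by
      clear_value m
      clear * - a0 a1 a2 n0 n1 n2
      grind
    refine ⟨?_, σ 0, fun i => ?_⟩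
    · simpa [this.1, this.2, Fin.sum_univ_three] using a0
    · fin_cases i <;> simp [this]
  · right
    have hm0 : m 0 ≠ 0 := fun h => mul_ne_zero hm2 (hα 0) (by rw [h] at e0; linarith)
    have hm1 : m 1 ≠ 0 := fun h => mul_ne_zero hm2 (hα 1) (by rw [h] at e1; linarith)
    have hex (j) (h : m j ≠ 0) : ∃ i, σ i = j := by
      by_contra! hj
      exact h (Finset.sum_eq_zero fun i _ => by simp [hj i])
    have hm' : ∀ j : Fin 3, m j.castSucc ≠ 0 := by intro j; fin_cases j <;> assumption
    choose τ hτ using fun j : Fin 3 => hex j.castSucc (hm' j)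
    have hinj : Function.Injective τ := fun i j e => by
      have := hτ i
      rw [e, hτ j] at this
      exact (Fin.castSucc_injective _ this).symm
    let ρ := Equiv.ofBijective τ ((Fintype.bijective_iff_injective_and_card τ).2 ⟨hinj, rfl⟩)
    have hρ (i) : σ i = (ρ.symm i).castSucc := by
      rw [← hτ (ρ.symm i)]
      exact congrArg σ (ρ.apply_symm_apply i).symm
    have hmα (j : Fin 3) : m j.castSucc = α (ρ j) := by
      simp only [m, hρ, Fin.castSucc_inj, Equiv.symm_apply_eq]
      simp
    -- All three offsets occur, so `m` is a rearrangement of `α` and has the same product. A vector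
    -- proportional to `α` with that product has the same cubes, hence equals `α`.
    have hprod : m 0 * m 1 * m 2 = α 0 * α 1 * α 2 := by
      have := Equiv.prod_comp ρ α
      rw [← Finset.prod_congr rfl fun j _ => hmα j] at this
      simpa [Fin.prod_univ_three] using this
    have hcube : m 2 ^ 3 = α 2 ^ 3 := by
      have : (α 0 * α 1) * (m 2 ^ 3) = (α 0 * α 1) * α 2 ^ 3 := by
        linear_combination (α 2 ^ 2) * hprod - m 2 * α 2 * m 1 * e0 - m 2 * m 2 * α 0 * e1
      exact mul_left_cancel₀ (mul_ne_zero (hα 0) (hα 1)) this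
    have hm2' : m 2 = α 2 := (Odd.strictMono_pow (by decide : Odd 3)).injective hcube
    have hfix : ∀ j : Fin 3, α (ρ j) = α j := by
      intro j
      rw [← hmα]
      rw [hm2'] at e0 e1
      have f0 : m 0 = α 0 := mul_right_cancel₀ (hα 2) (by linarith)
      have f1 : m 1 = α 1 := mul_right_cancel₀ (hα 2) (by linarith)
      fin_cases j <;> assumption
    exact ⟨ρ.symm, hρ, fun i => by rw [← hfix, ρ.apply_symm_apply]⟩

/-! ### The queries -/

/-- The constants of the reduction for the coefficients `α`: the offsets of the three given sets
and of the padding elements, and a scale that is large enough for the padded set to be sparse. -/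
structure ReductionData (α : Fin 3 → ℤ) where
  ne_zero : ∀ i, α i ≠ 0
  γ : Fin 4 → ℤ
  injective : Function.Injective γ
  sum_eq_zero : ∑ i : Fin 3, α i * γ i.castSucc = 0
  generic : ∀ σ : Fin 3 → Fin 4, ∑ i, α i * γ (σ i) = 0 →
    (∑ i, α i = 0 ∧ ∃ j, ∀ i, σ i = j) ∨
      ∃ π : Equiv.Perm (Fin 3), (∀ i, σ i = (π i).castSucc) ∧ ∀ i, α (π i) = α i
  K : ℤ
  le_scale : ∀ j, 4 * coeffNorm α ^ 3 * (|γ j| + 1) ≤ K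

theorem ReductionData.nonempty {α : Fin 3 → ℤ} (hα : ∀ i, α i ≠ 0) :
    Nonempty (ReductionData α) := by
  obtain ⟨γ, h₁, h₂, h₃⟩ := exists_generic_offsets α hα
  have hS := three_le_coeffNorm hα
  refine ⟨⟨hα, γ, h₁, h₂, h₃, ∑ j, 4 * coeffNorm α ^ 3 * (|γ j| + 1), fun j => ?_⟩⟩
  exact Finset.single_le_sum (f := fun j => 4 * coeffNorm α ^ 3 * (|γ j| + 1))
    (fun j _ => by positivity) (Finset.mem_univ j)

/-- Four lists, shifted by multiples of `D` and concatenated. -/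
def shiftedConcat (γ : Fin 4 → ℤ) (D : ℤ) (P : Fin 4 → List ℤ) : List ℤ :=
  (P 0).map (· + γ 0 * D) ++ (P 1).map (· + γ 1 * D) ++ (P 2).map (· + γ 2 * D) ++
    (P 3).map (· + γ 3 * D)

theorem mem_shiftedConcat {γ : Fin 4 → ℤ} {D : ℤ} {P : Fin 4 → List ℤ} {w : ℤ} :
    w ∈ shiftedConcat γ D P ↔ ∃ j, ∃ r ∈ P j, r + γ j * D = w := by
  simp [shiftedConcat, Fin.exists_fin_succ]

/-- Blocks of radius `ρ` around distinct multiples of `D > 2 * ρ` cannot meet. -/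
theorem disjoint_shift {γ : Fin 4 → ℤ} (hγ : Function.Injective γ) {D ρ : ℤ} (hD : 2 * ρ < D)
    {P : Fin 4 → List ℤ} (hP : ∀ j, ∀ r ∈ P j, |r| ≤ ρ) {i j : Fin 4} {r s : ℤ} (hr : r ∈ P i)
    (hs : s ∈ P j) (h : r + γ i * D = s + γ j * D) : i = j := by
  have hr' := abs_le.1 (hP i r hr)
  have hs' := abs_le.1 (hP j s hs)
  obtain ⟨h, -⟩ := eq_zero_of_mul_add_eq_zero (L := D) (x := γ i - γ j) (y := r - s)
    (by linarith) (by rw [abs_lt]; constructor <;> linarith)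
  exact hγ (by linarith)

theorem nodup_shiftedConcat {γ : Fin 4 → ℤ} (hγ : Function.Injective γ) {D ρ : ℤ} (hD : 2 * ρ < D)
    {P : Fin 4 → List ℤ} (hP : ∀ j, ∀ r ∈ P j, |r| ≤ ρ) (hn : ∀ j, (P j).Nodup) :
    (shiftedConcat γ D P).Nodup := by
  have hm (j) : ((P j).map (· + γ j * D)).Nodup :=
    (hn j).map fun _ _ h => add_right_cancel h
  have hd {i j : Fin 4} (hij : i ≠ j) :
      List.Disjoint ((P i).map (· + γ i * D)) ((P j).map (· + γ j * D)) := by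
    intro w hi hj
    obtain ⟨r, hr, rfl⟩ := List.mem_map.1 hi
    obtain ⟨s, hs, e⟩ := List.mem_map.1 hj
    exact hij (disjoint_shift hγ hD hP hr hs e.symm)
  rw [shiftedConcat]
  refine (((hm 0).append (hm 1) (hd (by decide))).append (hm 2) ?_).append (hm 3) ?_
  · exact List.disjoint_append_left.2 ⟨hd (by decide), hd (by decide)⟩
  · exact List.disjoint_append_left.2 ⟨List.disjoint_append_left.2
      ⟨hd (by decide), hd (by decide)⟩, hd (by decide)⟩

/-- The elements of a list that have a given colour, shifted. -/
def colourClass (S g : ℤ) (d n : ℕ) (p : ℤ) (L : List ℤ) : List ℤ :=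
  L.filter fun x => colour S g (x + (n : ℤ) ^ 3) d = p

/-! ### Size, distinctness and correctness of the padded queries -/

namespace ReductionData

variable {α : Fin 3 → ℤ} (R : ReductionData α)

/-- The number of values of the first coordinate of the padding elements. -/
def U (n : ℕ) : ℤ := R.K * (n + 1)

/-- The size of the queries. -/
def queryLen (n : ℕ) : ℕ := (R.K * R.K * (n + 1)).toNat

/-- A bound for the elements before shifting. -/
def radius (n : ℕ) : ℤ := coeffNorm α * R.K * (2 * coeffNorm α * R.U n * R.U n) * R.U n

/-- The unit of the shifts. -/
def gap (n : ℕ) : ℤ := 2 * coeffNorm α * R.radius n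

/-- The padding element at a given position. -/
def pad (n : ℕ) (a : ℤ) : ℤ :=
  padValue R.K (coeffNorm α * R.K * (2 * coeffNorm α * R.U n * R.U n))
    (2 * coeffNorm α * R.U n * R.U n) a

theorem three_le (R : ReductionData α) : 3 ≤ coeffNorm α := three_le_coeffNorm R.ne_zero

theorem coeffNorm_pos (R : ReductionData α) : 0 < coeffNorm α := by linarith [R.three_le]

theorem one_le_coeffNorm_pow (R : ReductionData α) (i : ℕ) : 1 ≤ coeffNorm α ^ i :=
  one_le_pow₀ (by linarith [R.three_le])

theorem scale_pos : 0 < R.K := by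
  have := R.three_le
  exact lt_of_lt_of_le (by positivity) (R.le_scale 0)

theorem four_le_scale : 4 ≤ R.K := by
  have h := R.three_le
  have h₁ : 1 ≤ coeffNorm α ^ 3 := one_le_pow₀ (by linarith)
  nlinarith [R.le_scale 0, abs_nonneg (R.γ 0)]

theorem scale_le_U (n : ℕ) : R.K ≤ R.U n := by
  rw [U]
  nlinarith [R.scale_pos]

/-- The size of a query equals the number `K * U` of available padding elements, so every position
in a query has one. -/
theorem cast_queryLen (n : ℕ) : (R.queryLen n : ℤ) = R.K * R.U n := by
  have := R.scale_pos
  rw [queryLen, Int.toNat_of_nonneg (by positivity), U, mul_assoc]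

theorem three_mul_le_queryLen (n : ℕ) : 3 * n ≤ R.queryLen n := by
  have h := R.cast_queryLen n
  have h₁ := R.four_le_scale
  rw [U] at h
  zify
  rw [h]
  have : 16 ≤ R.K * R.K := by nlinarith
  nlinarith

theorem succ_le_queryLen (n : ℕ) : n + 1 ≤ R.queryLen n := by
  have h := R.cast_queryLen n
  have h₁ := R.four_le_scale
  rw [U] at h
  zify
  rw [h]
  have : 16 ≤ R.K * R.K := by nlinarith
  nlinarith

theorem radius_pos (n : ℕ) : 0 < R.radius n := by
  have h₁ := R.three_le
  have h₂ := R.scale_pos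
  have h₃ := R.scale_le_U n
  have : 0 < R.U n := by linarith
  rw [radius]
  positivity

theorem cube_le_radius (n : ℕ) : (n : ℤ) ^ 3 ≤ R.radius n := by
  have h₁ := R.three_le
  have h₂ := R.scale_pos
  have h₃ := R.scale_le_U n
  have hn : (n : ℤ) ≤ R.U n := by rw [U]; nlinarith
  have hU : 0 < R.U n := by linarith
  have e : R.radius n = coeffNorm α * coeffNorm α * R.K * 2 * R.U n ^ 3 := by rw [radius]; ring
  have h₄ : (n : ℤ) ^ 3 ≤ R.U n ^ 3 := pow_le_pow_left₀ (by positivity) hn 3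
  have h₅ : 1 ≤ coeffNorm α * coeffNorm α * R.K * 2 := by
    have : 1 ≤ coeffNorm α * coeffNorm α := by nlinarith
    nlinarith
  have : 0 ≤ R.U n ^ 3 := by positivity
  rw [e]
  nlinarith

theorem two_mul_radius_lt_gap (n : ℕ) : 2 * R.radius n < R.gap n := by
  rw [gap]
  nlinarith [R.radius_pos n, R.three_le]

/-- This fixes the choice of `K`. The gap is `4 * S ^ 3 * K * U ^ 3`, so shifted elements are at
most `4 * S ^ 3 * (|γ j| + 1) * K * U ^ 3 ≤ K ^ 2 * U ^ 3`, while a query of size `K * U` allows `K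
^ 3 * U ^ 3`. -/
theorem shift_bound (n : ℕ) {j : Fin 4} {r : ℤ} (hr : |r| ≤ R.radius n) :
    |r + R.γ j * R.gap n| ≤ (R.queryLen n : ℤ) ^ 3 := by
  have h₀ := R.radius_pos n
  have h₁ := R.three_le
  have h₂ := R.le_scale j
  have h₃ := R.scale_pos
  have hU : 0 < R.U n := h₃.trans_le (R.scale_le_U n)
  have hγ := abs_nonneg (R.γ j)
  have hgap : 0 < R.gap n := by linarith [R.two_mul_radius_lt_gap n]
  calc |r + R.γ j * R.gap n| ≤ R.radius n + |R.γ j| * R.gap n := by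
        refine (abs_add_le _ _).trans (add_le_add hr ?_)
        rw [abs_mul, abs_of_pos hgap]
    _ ≤ 2 * coeffNorm α * R.radius n * (|R.γ j| + 1) := by
        rw [gap]
        nlinarith
    _ = 4 * coeffNorm α ^ 3 * (|R.γ j| + 1) * (R.K * R.U n ^ 3) := by rw [radius]; ring
    _ ≤ R.K * (R.K * R.U n ^ 3) := mul_le_mul_of_nonneg_right h₂ (by positivity)
    _ = 1 * (R.K * (R.K * R.U n ^ 3)) := by ring
    _ ≤ R.K * (R.K * (R.K * R.U n ^ 3)) := mul_le_mul_of_nonneg_right (by linarith) (by positivity)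
    _ = (R.queryLen n : ℤ) ^ 3 := by rw [cast_queryLen]; ring

variable (g : ℤ) (d n : ℕ) (L : Fin 3 → List ℤ) (p : Fin 3 → ℤ)

/-- The elements of the given sets that have the wanted colours. -/
def selected (i : Fin 3) : List ℤ := colourClass (coeffNorm α) g d n (p i) (L i)

/-- The number of elements of the given sets that have the wanted colours. -/
def selectedLen : ℕ :=
  (selected (α := α) g d n L p 0).length + (selected (α := α) g d n L p 1).length +
    (selected (α := α) g d n L p 2).length

/-- The padding elements, which bring the query up to its prescribed size. -/
def padding (a m : ℕ) : List ℤ := (List.range' a m).map fun i : ℕ => R.pad n i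

/-- The parts of the query for the colours `p`, before shifting. -/
def parts : Fin 4 → List ℤ :=
  ![selected (α := α) g d n L p 0, selected (α := α) g d n L p 1, selected (α := α) g d n L p 2,
    -- The padding index starts at the number of selected elements: a padding element is determined
    -- by its position in the query, so the machine can compute it from the current length.
    R.padding n (selectedLen (α := α) g d n L p) (R.queryLen n - selectedLen (α := α) g d n L p)]

/-- The query for the colours `p`. -/
def queryList : List ℤ := shiftedConcat R.γ (R.gap n) (R.parts g d n L p)

variable {g d n L p}

theorem parts_castSucc (i : Fin 3) :
    R.parts g d n L p i.castSucc = selected (α := α) g d n L p i := by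
  fin_cases i <;> rfl

theorem selectedLen_le (hL : ∀ i, (L i).length = n) :
    selectedLen (α := α) g d n L p ≤ R.queryLen n := by
  have h (i) : (selected (α := α) g d n L p i).length ≤ n :=
    (List.length_filter_le _ _).trans (hL i).le
  have := R.three_mul_le_queryLen n
  rw [selectedLen]
  linarith [h 0, h 1, h 2]

theorem length_queryList (hL : ∀ i, (L i).length = n) :
    (R.queryList g d n L p).length = R.queryLen n := by
  have := R.selectedLen_le (g := g) (d := d) (p := p) hL
  simp only [queryList, shiftedConcat, List.length_append, List.length_map, parts, padding,
    Matrix.cons_val, List.length_range']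
  rw [← selectedLen]
  omega

theorem mem_padding (hL : ∀ i, (L i).length = n) {r : ℤ} (hr : r ∈ R.parts g d n L p 3) :
    ∃ a : ℤ, 0 ≤ a ∧ a < R.K * R.U n ∧ r = R.pad n a := by
  have hle := R.selectedLen_le (g := g) (d := d) (p := p) hL
  simp only [parts, padding, Matrix.cons_val, List.mem_map, List.mem_range'_1] at hr
  obtain ⟨a, ha, rfl⟩ := hr
  refine ⟨a, by positivity, ?_, rfl⟩
  rw [← cast_queryLen]
  exact_mod_cast (by omega : a < R.queryLen n)

theorem abs_le_radius (hL : ∀ i, (L i).length = n) (hb : ∀ i, ∀ x ∈ L i, |x| ≤ (n : ℤ) ^ 3)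
    (j : Fin 4) (r : ℤ) (hr : r ∈ R.parts g d n L p j) : |r| ≤ R.radius n := by
  induction j using Fin.lastCases with
  | last =>
    obtain ⟨a, h₁, h₂, rfl⟩ := R.mem_padding hL hr
    have hS := R.three_le
    rw [pad, abs_of_nonneg (padValue_nonneg (by linarith) R.scale_pos (R.scale_le_U n) h₁ h₂)]
    exact (padValue_lt hS R.scale_pos (R.scale_le_U n) h₁ h₂).le
  | cast i =>
    rw [parts_castSucc] at hr
    exact (hb i r (List.mem_of_mem_filter hr)).trans (R.cube_le_radius n)

theorem nodup_queryList (hL : ∀ i, (L i).length = n) (hb : ∀ i, ∀ x ∈ L i, |x| ≤ (n : ℤ) ^ 3)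
    (hn : ∀ i, (L i).Nodup) : (R.queryList g d n L p).Nodup := by
  refine nodup_shiftedConcat R.injective (R.two_mul_radius_lt_gap n) (R.abs_le_radius hL hb)
    fun j => ?_
  induction j using Fin.lastCases with
  | last =>
    have hle := R.selectedLen_le (g := g) (d := d) (p := p) hL
    refine List.Nodup.map_on ?_ List.nodup_range'
    intro a ha b hb e
    rw [List.mem_range'_1] at ha hb
    have hlt (c : ℕ) (h : c < R.queryLen n) : (c : ℤ) < R.K * R.U n := by
      rw [← cast_queryLen]; exact_mod_cast h
    exact_mod_cast padValue_injOn R.three_le R.scale_pos (R.scale_le_U n) (by positivity)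
      (hlt a (by omega)) (by positivity) (hlt b (by omega)) e
  | cast i =>
    rw [parts_castSucc]
    exact (hn i).filter _

theorem queryList_bound (hL : ∀ i, (L i).length = n) (hb : ∀ i, ∀ x ∈ L i, |x| ≤ (n : ℤ) ^ 3)
    {w : ℤ} (hw : w ∈ R.queryList g d n L p) : |w| ≤ (R.queryLen n : ℤ) ^ 3 := by
  obtain ⟨j, r, hr, rfl⟩ := mem_shiftedConcat.1 hw
  exact R.shift_bound n (R.abs_le_radius hL hb j r hr)

/-- A solution of the tripartite problem gives a solution in the query for its colours. -/
theorem exists_solution_queryList (hL : ∀ i, (L i).length = n)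
    (hb : ∀ i, ∀ x ∈ L i, |x| ≤ (n : ℤ) ^ 3) {x : Fin 3 → ℤ} (hx : ∀ i, x i ∈ L i)
    (h : ∑ i, α i * x i = 0) (hp : ∀ i, colour (coeffNorm α) g (x i + (n : ℤ) ^ 3) d = p i) :
    ∃ w : Fin 3 → ℤ, Function.Injective w ∧ (∀ i, w i ∈ R.queryList g d n L p) ∧
      ∑ i, α i * w i = 0 := by
  have hmem (i : Fin 3) : x i ∈ R.parts g d n L p i.castSucc := by
    rw [parts_castSucc]
    exact List.mem_filter.2 ⟨hx i, by simpa using hp i⟩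
  refine ⟨fun i => x i + R.γ i.castSucc * R.gap n, fun i j e => ?_, fun i => ?_, ?_⟩
  · exact Fin.castSucc_injective _ (disjoint_shift R.injective (R.two_mul_radius_lt_gap n)
      (R.abs_le_radius hL hb) (hmem i) (hmem j) e)
  · exact mem_shiftedConcat.2 ⟨_, _, hmem i, rfl⟩
  · have := R.sum_eq_zero
    simp only [Fin.sum_univ_three] at *
    linear_combination h + R.gap n * this

/-- A solution in a query comes from a solution of the tripartite problem. -/
theorem exists_solution_of_queryList (hg : 0 < g) (hd : 2 * (n : ℤ) ^ 3 < (coeffNorm α * g) ^ d)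
    (hL : ∀ i, (L i).length = n) (hb : ∀ i, ∀ x ∈ L i, |x| ≤ (n : ℤ) ^ 3) {w : Fin 3 → ℤ}
    (hw : Function.Injective w) (hmem : ∀ i, w i ∈ R.queryList g d n L p)
    (h : ∑ i, α i * w i = 0) : ∃ x : Fin 3 → ℤ, (∀ i, x i ∈ L i) ∧ ∑ i, α i * x i = 0 := by
  choose σ r hr e using fun i => mem_shiftedConcat.1 (hmem i)
  have hrad := fun i => R.abs_le_radius hL hb (σ i) (r i) (hr i)
  have hS := R.three_le
  have hsmall : |∑ i, α i * r i| < R.gap n :=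
    (abs_sum_le_coeffNorm_mul α r hrad).trans_lt (by rw [gap]; nlinarith [R.radius_pos n])
  -- The unshifted part is below the gap, so the equation splits into one for the offsets and one
  -- for the elements.
  obtain ⟨h₁, h₂⟩ := eq_zero_of_mul_add_eq_zero (x := ∑ i, α i * R.γ (σ i)) (by
    simp only [Fin.sum_univ_three, ← e] at h ⊢
    linear_combination h) hsmall
  rcases R.generic σ h₁ with ⟨h₀, j, hj⟩ | ⟨π, hπ, hα⟩
  · exfalso
    suffices r 0 = r 1 by
      have : w 0 = w 1 := by rw [← e 0, ← e 1, hj 0, hj 1, this]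
      exact absurd (hw this) (by decide)
    simp only [hj] at hr
    induction j using Fin.lastCases with
    | last =>
      choose a ha haU hra using fun i => R.mem_padding hL (hr i)
      simp only [hra] at h₂ ⊢
      rw [eq_of_sum_padValue_eq_zero R.ne_zero h₀ R.scale_pos (R.scale_le_U n) ha haU h₂]
    | cast i =>
      simp only [parts_castSucc, selected, colourClass, List.mem_filter, decide_eq_true_eq] at hr
      have hb' (k) := abs_le.1 (hb i (r k) (hr k).1)
      -- Adding `n ^ 3` makes the elements nonnegative and preserves the equation, since `∑ i, α i =
      -- 0` in this case.
      have := eq_of_colour_eq R.ne_zero h₀ hg (v := fun k => r k + (n : ℤ) ^ 3) (d := d) (p := p i)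
        (fun k => by linarith [(hb' k).1])
        (fun k => by linarith [(hb' k).2]) (fun k => (hr k).2) (by
          simp only [Fin.sum_univ_three] at h₂ h₀ ⊢
          linear_combination h₂ + (n : ℤ) ^ 3 * h₀)
      simpa using this
  -- The element from block `i` carries a coefficient equal to `α i`, so sorting by blocks gives a
  -- tripartite solution. Colours play no role here.
  · refine ⟨fun i => r (π.symm i), fun i => ?_, ?_⟩
    · have := hr (π.symm i)
      rw [hπ, parts_castSucc, Equiv.apply_symm_apply] at this
      exact List.mem_of_mem_filter this
    · rw [← h₂, ← Equiv.sum_comp π]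
      simp [hα]

/-- The colours that the query with number `t` asks for, when there are `k` colours. -/
def wanted (k t : ℤ) : Fin 3 → ℤ := ![t % k, t / k % k, t / k / k % k]

/-- A triple of colours is read as a three-digit number in base `k`. -/
theorem exists_wanted_eq {k : ℤ} {p : Fin 3 → ℤ} (h₀ : ∀ i, 0 ≤ p i) (h₁ : ∀ i, p i < k) :
    ∃ t : ℕ, (t : ℤ) < k ^ 3 ∧ wanted k t = p := by
  have hk : 0 < k := (h₀ 0).trans_lt (h₁ 0)
  have a (i) := h₀ i
  have b (i) := h₁ i
  have hnn : 0 ≤ p 0 + k * (p 1 + k * p 2) :=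
    add_nonneg (a 0) (mul_nonneg hk.le (add_nonneg (a 1) (mul_nonneg hk.le (a 2))))
  refine ⟨(p 0 + k * (p 1 + k * p 2)).toNat, ?_, ?_⟩
  · rw [Int.toNat_of_nonneg hnn]
    have e₁ : p 1 + k * p 2 ≤ k * k - 1 := by nlinarith [b 1, b 2]
    nlinarith [b 0]
  · rw [Int.toNat_of_nonneg hnn]
    have e₁ : (p 0 + k * (p 1 + k * p 2)) / k = p 1 + k * p 2 := by
      rw [Int.add_mul_ediv_left _ _ hk.ne', Int.ediv_eq_zero_of_lt (a 0) (b 0), zero_add]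
    have e₂ : (p 1 + k * p 2) / k = p 2 := by
      rw [Int.add_mul_ediv_left _ _ hk.ne', Int.ediv_eq_zero_of_lt (a 1) (b 1), zero_add]
    funext i
    fin_cases i
    · simp [wanted, Int.emod_eq_of_lt (a 0) (b 0)]
    · simp [wanted, e₁, Int.emod_eq_of_lt (a 1) (b 1)]
    · simp [wanted, e₁, e₂, Int.emod_eq_of_lt (a 2) (b 2)]

/-- The number of colours. -/
def colourCount (S g : ℤ) (d : ℕ) : ℤ := S ^ d * (d * g * g + 1)

/-- The tripartite instance has a solution if and only if some query has a solution. -/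
theorem exists_solution_iff (hg : 0 < g) (hd : 2 * (n : ℤ) ^ 3 < (coeffNorm α * g) ^ d)
    (hL : ∀ i, (L i).length = n) (hb : ∀ i, ∀ x ∈ L i, |x| ≤ (n : ℤ) ^ 3) :
    (∃ x : Fin 3 → ℤ, (∀ i, x i ∈ L i) ∧ ∑ i, α i * x i = 0) ↔
      ∃ t : ℕ, (t : ℤ) < colourCount (coeffNorm α) g d ^ 3 ∧
        ∃ w : Fin 3 → ℤ, Function.Injective w ∧
          (∀ i, w i ∈ R.queryList g d n L (wanted (colourCount (coeffNorm α) g d) t)) ∧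
          ∑ i, α i * w i = 0 := by
  have hS : 0 < coeffNorm α := by linarith [R.three_le]
  constructor
  · rintro ⟨x, hx, h⟩
    obtain ⟨t, ht, e⟩ := exists_wanted_eq
      (p := fun i => colour (coeffNorm α) g (x i + (n : ℤ) ^ 3) d)
      (fun i => colour_nonneg hS hg d) (fun i => colour_lt hS hg d)
    exact ⟨t, ht, R.exists_solution_queryList hL hb hx h fun i => by erw [e]⟩
  · rintro ⟨t, -, w, hw, hmem, h⟩
    exact R.exists_solution_of_queryList hg hd hL hb hw hmem h

end ReductionData

/-! ### A program logic for the word RAM -/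

namespace WordRAM

/-- All registers and memory cells have absolute value at most `M`. -/
def State.Bounded (M : ℕ) (s : State) : Prop :=
  (∀ r, |s.reg r| ≤ (M : ℤ)) ∧ ∀ a, |s.mem a| ≤ (M : ℤ)

namespace State

variable {s : State} {M : ℕ}

theorem Bounded.setReg (h : s.Bounded M) {r : ℕ} {v : ℤ} (hv : |v| ≤ (M : ℤ)) :
    (s.setReg r v).Bounded M := by
  refine ⟨fun i => ?_, h.2⟩
  by_cases hi : i = r
  · subst hi; simpa [State.setReg] using hv
  · simpa [State.setReg, hi] using h.1 i

theorem Bounded.setMem (h : s.Bounded M) {a v : ℤ} (hv : |v| ≤ (M : ℤ)) :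
    (s.setMem a v).Bounded M := by
  refine ⟨h.1, fun i => ?_⟩
  by_cases hi : i = a
  · subst hi; simpa [State.setMem] using hv
  · simpa [State.setMem, hi] using h.2 i

@[simp]
theorem reg_setReg_self (s : State) (r : ℕ) (v : ℤ) : (s.setReg r v).reg r = v := by
  simp [setReg]

theorem reg_setReg_of_ne (s : State) {r i : ℕ} (v : ℤ) (h : i ≠ r) :
    (s.setReg r v).reg i = s.reg i := by
  simp [setReg, h]

@[simp]
theorem mem_setReg (s : State) (r : ℕ) (v : ℤ) : (s.setReg r v).mem = s.mem := rfl

@[simp]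
theorem reg_setMem (s : State) (a v : ℤ) : (s.setMem a v).reg = s.reg := rfl

@[simp]
theorem segment_setReg (s : State) (r : ℕ) (v a : ℤ) (k : ℕ) :
    (s.setReg r v).segment a k = s.segment a k := rfl

theorem segment_eq_map (s : State) (a : ℤ) (k : ℕ) :
    s.segment a k = (List.range k).map fun i : ℕ => s.mem (a + i) := by
  simp [segment, ← List.map_eq_flatMap, Function.comp_def]

theorem segment_setMem (s : State) (a v : ℤ) (k : ℕ) :
    (s.setMem (a + k) v).segment a (k + 1) = s.segment a k ++ [v] := by
  simp only [segment_eq_map, List.range_succ, List.map_append, List.map_cons, List.map_nil, setMem,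
    Function.update_self]
  congr 1
  refine List.map_congr_left fun i hi => ?_
  have := List.mem_range.1 hi
  exact Function.update_of_ne (by omega) _ _

end State

/-! ### Magnitude of the values that occur in evaluations -/

namespace Expr

/-- The constants of the expression have absolute value at most `M`. -/
def ConstLE (M : ℕ) : Expr → Prop
  | const z => |z| ≤ (M : ℤ)
  | reg _ => True
  | mem a => a.ConstLE M
  | bin _ e₁ e₂ => e₁.ConstLE M ∧ e₂.ConstLE M

/-- The exponents add up like the node counts in `Expr.cost`. The extra factor `M ≥ 2` pays for sums
and differences. -/
theorem BinOp.abs_eval_le (op : BinOp) {M x y : ℕ} (hM : 2 ≤ M) {a b : ℤ}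
    (ha : |a| ≤ (M : ℤ) ^ x) (hb : |b| ≤ (M : ℤ) ^ y) :
    |op.eval a b| ≤ (M : ℤ) ^ (x + y + 1) := by
  have hM' : (2 : ℤ) ≤ M := by exact_mod_cast hM
  have hx : 1 ≤ (M : ℤ) ^ x := one_le_pow₀ (by linarith)
  have hy : 1 ≤ (M : ℤ) ^ y := one_le_pow₀ (by linarith)
  have e : (M : ℤ) ^ (x + y + 1) = M ^ x * M ^ y * M := by ring
  have hxy : 1 ≤ (M : ℤ) ^ x * M ^ y := by nlinarith
  have hmul : (M : ℤ) ^ x * M ^ y ≤ (M : ℤ) ^ (x + y + 1) := by rw [e]; nlinarith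
  have hadd : (M : ℤ) ^ x + M ^ y ≤ (M : ℤ) ^ (x + y + 1) := by
    have : (M : ℤ) ^ x + M ^ y ≤ M ^ x * M ^ y * 2 := by nlinarith
    rw [e]; nlinarith
  cases op with
  | add => exact (abs_add_le _ _).trans ((add_le_add ha hb).trans hadd)
  | sub => exact (abs_sub _ _).trans ((add_le_add ha hb).trans hadd)
  | mul =>
    rw [BinOp.eval, abs_mul]
    exact (mul_le_mul ha hb (abs_nonneg _) (by positivity)).trans hmul
  | div =>
    rw [BinOp.eval]
    have := Int.abs_ediv_le_abs a b
    nlinarith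
  | mod =>
    rw [BinOp.eval]
    rcases eq_or_ne b 0 with rfl | hb0
    · rw [Int.emod_zero]; linarith
    · rw [abs_of_nonneg (Int.emod_nonneg _ hb0)]
      have := Int.emod_lt_abs a hb0
      linarith
  | lt =>
    rw [BinOp.eval]
    split_ifs
    · rw [abs_one]; linarith
    · rw [abs_zero]; linarith
  | eq =>
    rw [BinOp.eval]
    split_ifs
    · rw [abs_one]; linarith
    · rw [abs_zero]; linarith

theorem abs_eval_le {M : ℕ} (hM : 2 ≤ M) {s : State} (hs : s.Bounded M) {e : Expr}
    (he : e.ConstLE M) : |e.eval s| ≤ (M : ℤ) ^ e.cost := by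
  have hM' : (1 : ℤ) ≤ M := by exact_mod_cast (by omega : 1 ≤ M)
  induction e with
  | const z => simpa [cost, eval, ConstLE] using he
  | reg r => simpa [cost, eval] using hs.1 r
  | mem a => exact (hs.2 _).trans (le_self_pow₀ hM' (by simp [cost]))
  | bin op e₁ e₂ ih₁ ih₂ => exact BinOp.abs_eval_le op hM (ih₁ he.1) (ih₂ he.2)

theorem fits_of_constLE {M W : ℕ} (hM : 2 ≤ M) {s : State} (hs : s.Bounded M) {e : Expr}
    (he : e.ConstLE M) (hW : M ^ e.cost ≤ W) : e.Fits W s := by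
  have hle := (abs_eval_le hM hs he).trans (by exact_mod_cast hW : (M : ℤ) ^ e.cost ≤ W)
  induction e with
  | const z => exact hle
  | reg r => exact hle
  | mem a ih =>
    have h₁ : M ^ a.cost ≤ W := (Nat.pow_le_pow_right (by omega) (by simp [cost])).trans hW
    exact ⟨ih he h₁ ((abs_eval_le (e := a) hM hs he).trans (by exact_mod_cast h₁)), hle⟩
  | bin op e₁ e₂ ih₁ ih₂ =>
    have h₁ : M ^ e₁.cost ≤ W :=
      (Nat.pow_le_pow_right (by omega) (by simp [cost]; omega)).trans hW
    have h₂ : M ^ e₂.cost ≤ W :=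
      (Nat.pow_le_pow_right (by omega) (by simp [cost]; omega)).trans hW
    exact ⟨ih₁ he.1 h₁ ((abs_eval_le hM hs he.1).trans (by exact_mod_cast h₁)),
      ih₂ he.2 h₂ ((abs_eval_le hM hs he.2).trans (by exact_mod_cast h₂)), hle⟩

/-- Expressions that can be evaluated with words of absolute value `M ^ 100` in any state whose
values are bounded by `M`. -/
def Feasible (M : ℕ) (e : Expr) : Prop := e.ConstLE M ∧ e.cost ≤ 100

theorem Feasible.fits {M W : ℕ} (hM : 2 ≤ M) (hW : M ^ 100 ≤ W) {s : State} (hs : s.Bounded M)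
    {e : Expr} (he : e.Feasible M) : e.Fits W s :=
  fits_of_constLE hM hs he.1 ((Nat.pow_le_pow_right (by omega) he.2).trans hW)

end Expr

/-- The program halts within time `τ`, after exactly `c` oracle calls, all of size `N`, in a state
that satisfies `Post`. -/
def Exec (B : DecisionProblem) (W N : ℕ) (p : Program) (s : State) (τ c : ℕ)
    (Post : State → Prop) : Prop :=
  ∃ s' T, Run B W p s s' T (List.replicate c N) ∧ T ≤ τ ∧ Post s'

/-! ### Rules for termination, running time and number of queries -/

namespace Exec

variable {B : DecisionProblem} {W N M : ℕ} {p q : Program} {s : State} {τ τ' c c' : ℕ}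
  {Post Post' : State → Prop} {e : Expr}

theorem mono (h : Exec B W N p s τ c Post) (hτ : τ ≤ τ') (hP : ∀ s', Post s' → Post' s') :
    Exec B W N p s τ' c Post' := by
  obtain ⟨s', T, h₁, h₂, h₃⟩ := h
  exact ⟨s', T, h₁, h₂.trans hτ, hP s' h₃⟩

theorem skip (h : Post s) : Exec B W N .skip s 1 0 Post := ⟨s, 1, .skip s, le_rfl, h⟩

theorem assign {r : ℕ} (he : e.Fits W s) (h : Post (s.setReg r (e.eval s))) :
    Exec B W N (.assign r e) s (e.cost + 1) 0 Post :=
  ⟨_, _, .assign he, le_rfl, h⟩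

theorem store {a : Expr} (ha : a.Fits W s) (he : e.Fits W s)
    (h : Post (s.setMem (a.eval s) (e.eval s))) :
    Exec B W N (.store a e) s (a.cost + e.cost + 1) 0 Post :=
  ⟨_, _, .store ha he, le_rfl, h⟩

theorem seq (h : Exec B W N p s τ c fun s₁ => Exec B W N q s₁ τ' c' Post) :
    Exec B W N (.seq p q) s (τ + τ') (c + c') Post := by
  obtain ⟨s₁, T₁, h₁, h₂, s₂, T₂, h₃, h₄, h₅⟩ := h
  refine ⟨s₂, T₁ + T₂, ?_, by omega, h₅⟩
  rw [← List.replicate_append_replicate]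
  exact .seq h₁ h₃

theorem seq_free (h : Exec B W N p s τ 0 fun s₁ => Exec B W N q s₁ τ' c' Post) :
    Exec B W N (.seq p q) s (τ + τ') c' Post := by
  simpa using seq h

theorem ite (he : e.Fits W s) (h₁ : e.eval s ≠ 0 → Exec B W N p s τ c Post)
    (h₂ : e.eval s = 0 → Exec B W N q s τ c Post) :
    Exec B W N (.ite e p q) s (e.cost + 1 + τ) c Post := by
  by_cases h : e.eval s = 0
  · obtain ⟨s', T, g₁, g₂, g₃⟩ := h₂ h
    exact ⟨s', _, .iteFalse he h g₁, by omega, g₃⟩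
  · obtain ⟨s', T, g₁, g₂, g₃⟩ := h₁ h
    exact ⟨s', _, .iteTrue he h g₁, by omega, g₃⟩

/-- The invariant is indexed by the number of completed iterations, and the condition must hold
exactly while fewer than `m` are completed. Each iteration makes the same number of calls, so the
list of query sizes remains constant. -/
theorem loop {I : ℕ → State → Prop} (m : ℕ)
    (hcond : ∀ i ≤ m, ∀ s, I i s → e.Fits W s ∧ (e.eval s ≠ 0 ↔ i < m))
    (hbody : ∀ i < m, ∀ s, I i s → Exec B W N p s τ c (I (i + 1))) (h₀ : I 0 s) :
    Exec B W N (.loop e p) s (m * (e.cost + 1 + τ) + (e.cost + 1)) (m * c) (I m) := by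
  suffices H : ∀ j i, i + j = m → ∀ s, I i s →
      Exec B W N (.loop e p) s (j * (e.cost + 1 + τ) + (e.cost + 1)) (j * c) (I m) from
    H m 0 (by omega) s h₀
  intro j
  induction j with
  | zero =>
    intro i hi s hs
    obtain rfl : i = m := by omega
    obtain ⟨h₁, h₂⟩ := hcond i le_rfl s hs
    refine ⟨s, e.cost + 1, ?_, by omega, hs⟩
    simpa using Run.loopDone h₁ (by simpa using h₂)
  | succ j ih =>
    intro i hi s hs
    obtain ⟨h₁, h₂⟩ := hcond i (by omega) s hs
    obtain ⟨s₁, T₁, g₁, g₂, g₃⟩ := hbody i (by omega) s hs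
    obtain ⟨s₂, T₂, g₄, g₅, g₆⟩ := ih (i + 1) (by omega) s₁ g₃
    refine ⟨s₂, e.cost + 1 + T₁ + T₂, ?_, ?_, g₆⟩
    · have := Run.loopStep h₁ (h₂.2 (by omega)) g₁ g₄
      rwa [List.replicate_append_replicate, show c + j * c = (j + 1) * c by ring] at this
    · have : (j + 1) * (e.cost + 1 + τ) = e.cost + 1 + τ + j * (e.cost + 1 + τ) := by ring
      omega

theorem query {r : ℕ} {a k : Expr} {y : B.Inst} (ha : a.Fits W s) (hk : k.Fits W s)
    (hlen : k.eval s = (N : ℤ)) (hy : B.Encodes y (s.segment (a.eval s) N)) (hN : B.size y = N)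
    (h₁ : B.Yes y → Post (s.setReg r 1)) (h₀ : ¬B.Yes y → Post (s.setReg r 0)) :
    Exec B W N (.query r a k) s (a.cost + k.cost + N + 1) 1 Post := by
  by_cases h : B.Yes y
  · refine ⟨_, _, ?_, le_rfl, h₁ h⟩
    simpa [hN] using Run.query (r := r) ha hk hlen hy (Or.inl ⟨h, rfl⟩)
  · refine ⟨_, _, ?_, le_rfl, h₀ h⟩
    simpa [hN] using Run.query (r := r) ha hk hlen hy (Or.inr ⟨h, rfl⟩)

end Exec

end WordRAM

/-! ### The program of the reduction -/

namespace WordRAM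

namespace Expr

abbrev add (a b : Expr) : Expr := bin .add a b
abbrev mul (a b : Expr) : Expr := bin .mul a b
abbrev div (a b : Expr) : Expr := bin .div a b
abbrev mod (a b : Expr) : Expr := bin .mod a b
abbrev lt (a b : Expr) : Expr := bin .lt a b
abbrev eq (a b : Expr) : Expr := bin .eq a b

end Expr

/-- `s'` arises from `s` without changing the registers below `r`. -/
def State.Agree (r : ℕ) (s s' : State) : Prop := ∀ i < r, s'.reg i = s.reg i

namespace State.Agree

variable {r r' : ℕ} {s s' s'' : State}

theorem refl (r : ℕ) (s : State) : s.Agree r s := fun _ _ => rfl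

theorem trans (h : s.Agree r s') (h' : s'.Agree r s'') : s.Agree r s'' :=
  fun i hi => (h' i hi).trans (h i hi)

theorem mono (h : s.Agree r s') (hr : r' ≤ r) : s.Agree r' s' := fun i hi => h i (hi.trans_le hr)

theorem setReg (h : s.Agree r s') {i : ℕ} (hi : r ≤ i) (v : ℤ) : s.Agree r (s'.setReg i v) :=
  fun j hj => (State.reg_setReg_of_ne _ _ (by omega)).trans (h j hj)

theorem setMem (h : s.Agree r s') (a v : ℤ) : s.Agree r (s'.setMem a v) := h

end State.Agree

end WordRAM

namespace ReductionData

open WordRAM Expr Program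

variable {α : Fin 3 → ℤ} (R : ReductionData α)

/-- The coefficient of `(n + 1) ^ 3` in the shift of the `j`-th part. -/
def shiftCoeff (j : Fin 4) : ℤ := R.γ j * (4 * coeffNorm α ^ 3 * R.K ^ 4)

/-- The coefficient of `(n + 1) ^ 2` in the weight of the second coordinate of the padding. -/
def padCoeff : ℤ := 2 * coeffNorm α * R.K * R.K

/-- The coefficient of `(n + 1) ^ 2` in the weight of the first coordinate of the padding. -/
def padCoeff' : ℤ := coeffNorm α * R.K * (2 * coeffNorm α * R.K * R.K)

theorem shift_eq (j : Fin 4) (n : ℕ) :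
    R.γ j * R.gap n = R.shiftCoeff j * (((n : ℤ) + 1) * (n + 1) * (n + 1)) := by
  rw [gap, radius, U, shiftCoeff]; ring

/-- Processes the lowest digit of `reg 14`. -/
def digitStep (S : ℤ) : Program :=
  .seq (.assign 15 (add (mul (reg 15) (const S))
    (div (mod (reg 14) (mul (const S) (reg 3))) (reg 3)))) <|
  .seq (.assign 16 (add (reg 16)
    (mul (mod (mod (reg 14) (mul (const S) (reg 3))) (reg 3))
      (mod (mod (reg 14) (mul (const S) (reg 3))) (reg 3))))) <|
  .seq (.assign 14 (div (reg 14) (mul (const S) (reg 3)))) <|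
  .assign 17 (add (reg 17) (const 1))

/-- Computes the colour code of the list element at address `reg 10` into registers `15`, `16`. -/
def colourProgram (S : ℤ) : Program :=
  .seq (.assign 14 (add (mem (reg 10)) (mul (mul (reg 1) (reg 1)) (reg 1)))) <|
  .seq (.assign 15 (const 0)) <| .seq (.assign 16 (const 0)) <| .seq (.assign 17 (const 0)) <|
  .loop (lt (reg 17) (reg 2)) (digitStep S)

/-- The expression `n + 1`. -/
def succSize : Expr := add (reg 1) (const 1)

/-- The shift of the `j`-th part. -/
def shiftExpr (j : Fin 4) : Expr :=
  mul (const (R.shiftCoeff j)) (mul (mul succSize succSize) succSize)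

/-- Appends the list element at address `reg 10` to the query if it has the wanted colour. -/
def selectStep (j : Fin 4) : Program :=
  .seq (colourProgram (coeffNorm α)) <|
  .seq (.ite (eq (add (mul (reg 15) (add (mul (mul (reg 2) (reg 3)) (reg 3)) (const 1))) (reg 16))
      (reg 12))
    (.seq (.store (add (reg 0) (reg 9)) (add (mem (reg 10)) (R.shiftExpr j)))
      (.assign 9 (add (reg 9) (const 1))))
    .skip) <|
  .assign 10 (add (reg 10) (const 1))

/-- Appends the elements of the next list that have the wanted colour to the query. -/
def selectProgram (j : Fin 4) : Program :=
  .seq (.assign 12 (mod (reg 11) (reg 6))) <|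
  .seq (.assign 11 (div (reg 11) (reg 6))) <|
  .seq (.assign 13 (add (reg 13) (reg 1))) <|
  .loop (lt (reg 10) (reg 13)) (R.selectStep j)

/-- The padding element at position `reg 9`, shifted. -/
def padExpr : Expr :=
  add (add (add (mul (mul (const R.padCoeff') (mul succSize succSize)) (div (reg 9) (const R.K)))
      (mul (mul (const R.padCoeff) (mul succSize succSize)) (mod (reg 9) (const R.K))))
    (add (mul (div (reg 9) (const R.K)) (div (reg 9) (const R.K)))
      (mul (mod (reg 9) (const R.K)) (mod (reg 9) (const R.K)))))
    (R.shiftExpr 3)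

/-- The size of the queries. -/
def queryLenExpr : Expr := mul (const (R.K * R.K)) succSize

/-- Brings the query up to its prescribed size. -/
def padProgram : Program :=
  .loop (lt (reg 9) R.queryLenExpr) <|
    .seq (.store (add (reg 0) (reg 9)) R.padExpr) (.assign 9 (add (reg 9) (const 1)))

/-- Builds the query with number `reg 7`, submits it, and moves on to the next number. -/
def queryProgram : Program :=
  -- Register `9` counts the words written so far, `10` is the reading address, `11` holds the
  -- unread base-`k` digits of the query number, `12` the wanted colour and `13` the end of the
  -- current list. The query is written from address `reg 0 = 3 * n` on, right behind the input.
  .seq (.assign 9 (const 0)) <| .seq (.assign 10 (const 0)) <| .seq (.assign 11 (reg 7)) <|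
  .seq (.assign 13 (const 0)) <|
  .seq (R.selectProgram 0) <| .seq (R.selectProgram 1) <| .seq (R.selectProgram 2) <|
  .seq R.padProgram <|
  .seq (.query 14 (reg 0) R.queryLenExpr) <|
  -- The disjunction of two truth values.
  .seq (.assign 8 (lt (const 0) (add (reg 8) (reg 14)))) <|
  .assign 7 (add (reg 7) (const 1))

/-- Passes from `d` to `d + 1` digits. -/
def setupStep (S : ℤ) : Program :=
  -- Uses `(j + 1) ^ 2 = j ^ 2 + 2 * j + 1`; register `3` must still hold `2 ^ j` here.
  .seq (.assign 4 (mul (reg 4) (mul (mul (reg 3) (reg 3)) (const 2)))) <|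
  .seq (.assign 3 (mul (reg 3) (const 2))) <|
  .seq (.assign 5 (mul (reg 5) (const S))) <|
  .assign 2 (add (reg 2) (const 1))

/-- Computes the number of digits `d`, the number `2 ^ d` and the number of colours. -/
def setupProgram (S : ℤ) : Program :=
  .seq (.assign 1 (div (reg 0) (const 3))) <|
  -- Registers `2` to `5` hold `j`, `2 ^ j`, `2 ^ (j * j)` and `S ^ j`, starting from `j = 1`.
  .seq (.assign 2 (const 1)) <| .seq (.assign 3 (const 2)) <| .seq (.assign 4 (const 2)) <|
  .seq (.assign 5 (const S)) <|
  .seq (.loop (lt (reg 4) (add (mul (const 2) (mul (mul (reg 1) (reg 1)) (reg 1))) (const 1)))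
    (setupStep S)) <|
  .assign 6 (mul (reg 5) (add (mul (mul (reg 2) (reg 3)) (reg 3)) (const 1)))

/-- The reduction. -/
def reduction : Program :=
  .seq (setupProgram (coeffNorm α)) <|
  -- Registers `7` and `8`, the query counter and the accumulated answer, still have their initial
  -- value `0`. All `k ^ 3` queries are asked, with no early exit.
  .seq (.loop (lt (reg 7) (mul (mul (reg 6) (reg 6)) (reg 6))) R.queryProgram) <|
  .assign 0 (reg 8)

/-- The data of one run of the reduction: the three lists, the number of digits, and the bounds for
the values that occur. -/
structure Env where
  n : ℕ
  d : ℕ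
  L : Fin 3 → List ℤ
  M : ℕ
  W : ℕ
  length_eq : ∀ i, (L i).length = n
  nodup : ∀ i, (L i).Nodup
  bound : ∀ i, ∀ x ∈ L i, |x| ≤ (n : ℤ) ^ 3
  lt_pow : 2 * (n : ℤ) ^ 3 < 2 ^ (d * d)
  pow_le : M ^ 100 ≤ W
  coeffNorm_le : coeffNorm α ≤ M
  scale_sq_le : R.K * R.K ≤ M
  padCoeff_le : R.padCoeff ≤ M
  padCoeff'_le : R.padCoeff' ≤ M
  shiftCoeff_le : ∀ j, |R.shiftCoeff j| ≤ M
  queryLen_le : (R.queryLen n : ℤ) ^ 3 ≤ M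
  one_le : 1 ≤ d
  pow_sq_le : (2 : ℤ) ^ (d * d) ≤ M
  -- Minimality makes the machine's search stop at exactly this `d`, and it is what keeps the number
  -- of colours subpolynomial.
  minimal : ∀ j < d, 1 ≤ j → (2 : ℤ) ^ (j * j) ≤ 2 * (n : ℤ) ^ 3
  count_le : colourCount (coeffNorm α) (2 ^ d) d ^ 3 ≤ M

/-! ### Invariants of a run and the computation of colours -/

namespace Env

variable {R} (E : R.Env)

/-- The number of colours. -/
def k : ℤ := colourCount (coeffNorm α) (2 ^ E.d) E.d

/-- The size of the queries. -/
def N : ℕ := R.queryLen E.n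

theorem sixteen_le (E : R.Env) : (16 : ℤ) ≤ E.M := by
  nlinarith [R.four_le_scale, E.scale_sq_le]

theorem two_le : 2 ≤ E.M := by
  have := E.sixteen_le
  omega

theorem base_pos (E : R.Env) : (0 : ℤ) < 2 ^ E.d := by positivity

theorem lt_base_pow : 2 * (E.n : ℤ) ^ 3 < (coeffNorm α * 2 ^ E.d) ^ E.d := by
  refine E.lt_pow.trans_le ?_
  rw [pow_mul]
  refine pow_le_pow_left₀ E.base_pos.le ?_ _
  nlinarith [E.base_pos, R.three_le]

theorem queryLen_pos : 0 < E.N := by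
  have := R.succ_le_queryLen E.n
  rw [N]
  omega

theorem N_le : (E.N : ℤ) ≤ E.M := by
  have h : (1 : ℤ) ≤ E.N := by exact_mod_cast E.queryLen_pos
  exact (le_self_pow₀ h (by norm_num)).trans E.queryLen_le

theorem three_n_le : 3 * E.n ≤ E.N := R.three_mul_le_queryLen E.n

theorem two_cube_le : 2 * (E.n : ℤ) ^ 3 ≤ E.M := by
  have h : 3 * (E.n : ℤ) ≤ E.N := by exact_mod_cast E.three_n_le
  have h₁ : (3 * (E.n : ℤ)) ^ 3 ≤ (E.N : ℤ) ^ 3 := pow_le_pow_left₀ (by positivity) h 3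
  have h₂ := E.queryLen_le
  have : (0 : ℤ) ≤ (E.n : ℤ) ^ 3 := by positivity
  rw [N] at h₁
  nlinarith

theorem k_pos : 1 ≤ E.k := by
  have h := R.one_le_coeffNorm_pow E.d
  rw [k, colourCount]
  have : (0 : ℤ) ≤ E.d * 2 ^ E.d * 2 ^ E.d := by positivity
  nlinarith

theorem k_le : E.k ≤ E.M := (le_self_pow₀ E.k_pos (by norm_num)).trans E.count_le

theorem S_pow_le : coeffNorm α ^ E.d ≤ E.k := by
  have h := R.one_le_coeffNorm_pow E.d
  rw [k, colourCount]
  have : (0 : ℤ) ≤ E.d * 2 ^ E.d * 2 ^ E.d := by positivity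
  nlinarith

theorem digits_sq_le : (E.d : ℤ) * 2 ^ E.d * 2 ^ E.d ≤ E.k := by
  have h := R.one_le_coeffNorm_pow E.d
  rw [k, colourCount]
  have : (0 : ℤ) ≤ E.d * 2 ^ E.d * 2 ^ E.d := by positivity
  nlinarith

theorem d_le : (E.d : ℤ) ≤ E.k := by
  refine le_trans ?_ E.digits_sq_le
  have h : (1 : ℤ) ≤ 2 ^ E.d := one_le_pow₀ (by norm_num)
  have h' : (0 : ℤ) ≤ E.d := by positivity
  have : (E.d : ℤ) * 1 ≤ E.d * 2 ^ E.d := mul_le_mul_of_nonneg_left h h'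
  nlinarith

/-- What holds throughout the main loop. -/
structure Ctx (s : State) : Prop where
  bounded : s.Bounded E.M
  reg0 : s.reg 0 = 3 * E.n
  reg1 : s.reg 1 = E.n
  reg2 : s.reg 2 = E.d
  reg3 : s.reg 3 = 2 ^ E.d
  reg6 : s.reg 6 = E.k
  input : ∀ (i : Fin 3) (a : ℕ) (h : a < E.n),
    s.mem ((i : ℕ) * E.n + a) = (E.L i)[a]'((E.length_eq i).symm ▸ h)

variable {E} {s : State}

theorem Ctx.setReg (h : E.Ctx s) {r : ℕ} {v : ℤ} (hr : 7 ≤ r) (hv : |v| ≤ (E.M : ℤ)) :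
    E.Ctx (s.setReg r v) where
  bounded := h.bounded.setReg hv
  reg0 := by rw [State.reg_setReg_of_ne _ _ (by omega), h.reg0]
  reg1 := by rw [State.reg_setReg_of_ne _ _ (by omega), h.reg1]
  reg2 := by rw [State.reg_setReg_of_ne _ _ (by omega), h.reg2]
  reg3 := by rw [State.reg_setReg_of_ne _ _ (by omega), h.reg3]
  reg6 := by rw [State.reg_setReg_of_ne _ _ (by omega), h.reg6]
  input := h.input

/-- The input occupies the addresses below `3 * n`, so writing into the query buffer leaves it
intact. -/
theorem Ctx.setMem (h : E.Ctx s) {a : ℕ} {v : ℤ} (hv : |v| ≤ (E.M : ℤ)) :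
    E.Ctx (s.setMem (3 * E.n + a) v) where
  bounded := h.bounded.setMem hv
  reg0 := h.reg0
  reg1 := h.reg1
  reg2 := h.reg2
  reg3 := h.reg3
  reg6 := h.reg6
  input := fun i b hb => by
    rw [← h.input i b hb]
    refine Function.update_of_ne ?_ _ _
    have h₁ : (i : ℕ) * E.n ≤ 2 * E.n := Nat.mul_le_mul_right _ (by omega)
    omega

theorem fits {e : Expr} (hs : s.Bounded E.M) (he : e.Feasible E.M) : e.Fits E.W s :=
  he.fits E.two_le E.pow_le hs

theorem Ctx.assign (h : E.Ctx s) {r : ℕ} {e : Expr} {Post : State → Prop} (v : ℤ) (hr : 7 ≤ r)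
    (he : e.Feasible E.M) (hv : e.eval s = v) (hb : |v| ≤ (E.M : ℤ))
    (hPost : E.Ctx (s.setReg r v) → Post (s.setReg r v)) :
    Exec (LDT1 α 0) E.W E.N (.assign r e) s (e.cost + 1) 0 Post :=
  .assign (fits h.bounded he) (hv ▸ hPost (h.setReg hr hb))

theorem abs_const_le {z : ℤ} (h₀ : 0 ≤ z) (h₁ : z ≤ 16) : |z| ≤ (E.M : ℤ) := by
  rw [abs_of_nonneg h₀]
  linarith [E.sixteen_le]

theorem abs_coeffNorm_le (E : R.Env) : |coeffNorm α| ≤ (E.M : ℤ) := by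
  rw [abs_of_pos R.coeffNorm_pos]
  exact E.coeffNorm_le

theorem Ctx.exec_digitStep (h : E.Ctx s) {v : ℤ} (hv₀ : 0 ≤ v) (hv : v ≤ E.M) {i : ℕ}
    (hi : i < E.d) (h14 : s.reg 14 = quo (coeffNorm α) (2 ^ E.d) v i)
    (h15 : s.reg 15 = hiCode (coeffNorm α) (2 ^ E.d) v i)
    (h16 : s.reg 16 = loNorm (coeffNorm α) (2 ^ E.d) v i) (h17 : s.reg 17 = i) :
    Exec (LDT1 α 0) E.W E.N (digitStep (coeffNorm α)) s 50 0 fun s' =>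
      E.Ctx s' ∧ s.Agree 14 s' ∧ s'.mem = s.mem ∧
        s'.reg 14 = quo (coeffNorm α) (2 ^ E.d) v (i + 1) ∧
        s'.reg 15 = hiCode (coeffNorm α) (2 ^ E.d) v (i + 1) ∧
        s'.reg 16 = loNorm (coeffNorm α) (2 ^ E.d) v (i + 1) ∧ s'.reg 17 = (i + 1 : ℕ) := by
  have hS := R.coeffNorm_pos
  have hg := E.base_pos
  have hSM := E.abs_coeffNorm_le
  have h1 : 1 ≤ E.M := by linarith [E.two_le]
  -- Partial codes and norms stay machine words because `S ^ d` and `d * g * g` are both at most the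
  -- number of colours.
  have hle : ∀ j ≤ E.d, coeffNorm α ^ j ≤ E.M := fun j hj =>
    (pow_le_pow_right₀ (by linarith) hj).trans (E.S_pow_le.trans E.k_le)
  refine Exec.mono (.seq_free <| h.assign (hiCode (coeffNorm α) (2 ^ E.d) v (i + 1)) (by norm_num)
    ?_ ?_ ?_ fun c₁ => .seq_free <| c₁.assign (loNorm (coeffNorm α) (2 ^ E.d) v (i + 1))
    (by norm_num) ?_ ?_ ?_ fun c₂ => .seq_free <| c₂.assign (quo (coeffNorm α) (2 ^ E.d) v (i + 1))
    (by norm_num) ?_ ?_ ?_ fun c₃ => c₃.assign ((i + 1 : ℕ) : ℤ) (by norm_num) ?_ ?_ ?_ fun c₄ =>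
      ⟨c₄, ?_, ?_, ?_, ?_, ?_, ?_⟩) ?_ fun _ h => h
  · simp [Feasible, ConstLE, Expr.cost, hSM]
  · simp [Expr.eval, BinOp.eval, h.reg3, h14, h15, hiCode]
  · rw [abs_of_nonneg (hiCode_nonneg hS hg _)]
    exact (hiCode_lt hS hg _).le.trans (hle _ hi)
  · simp [Feasible, ConstLE, Expr.cost, hSM]
  · simp [Expr.eval, BinOp.eval, c₁.reg3, State.reg_setReg_of_ne, h14, h16, loNorm]
  · rw [abs_of_nonneg (loNorm_nonneg _)]
    refine (loNorm_le hg _).trans (le_trans ?_ (E.digits_sq_le.trans E.k_le))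
    have : ((i + 1 : ℕ) : ℤ) ≤ E.d := by exact_mod_cast hi
    gcongr
  · simp [Feasible, ConstLE, Expr.cost, hSM]
  · simp [Expr.eval, BinOp.eval, c₂.reg3, State.reg_setReg_of_ne, h14, quo]
  · rw [abs_of_nonneg (quo_nonneg hS hg hv₀ _)]
    exact (quo_le hS hg hv₀ _).trans hv
  · simp [Feasible, ConstLE, Expr.cost, h1]
  · simp [Expr.eval, BinOp.eval, State.reg_setReg_of_ne, h17]
  · rw [abs_of_nonneg (by positivity)]
    exact le_trans (by exact_mod_cast hi) (E.d_le.trans E.k_le)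
  · simp [Expr.cost]
  · exact ((((State.Agree.refl _ _).setReg (by norm_num) _).setReg (by norm_num) _).setReg
      (by norm_num) _).setReg (by norm_num) _
  · rfl
  all_goals simp [State.reg_setReg_of_ne]

/-- The digit loop computes the colour code. -/
theorem Ctx.exec_colourProgram (h : E.Ctx s) {i : Fin 3} {x : ℤ} (hx : x ∈ E.L i)
    (hmem : s.mem (s.reg 10) = x) :
    Exec (LDT1 α 0) E.W E.N (colourProgram (coeffNorm α)) s (60 * (E.d + 1)) 0 fun s' =>
      E.Ctx s' ∧ s.Agree 14 s' ∧ s'.mem = s.mem ∧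
        s'.reg 15 = hiCode (coeffNorm α) (2 ^ E.d) (x + (E.n : ℤ) ^ 3) E.d ∧
        s'.reg 16 = loNorm (coeffNorm α) (2 ^ E.d) (x + (E.n : ℤ) ^ 3) E.d := by
  set v := x + (E.n : ℤ) ^ 3 with hv
  have hxb := abs_le.1 (E.bound i x hx)
  have hv0 : 0 ≤ v := by linarith
  have hvM : v ≤ E.M := by linarith [E.two_cube_le]
  have h0 := abs_const_le (E := E) (z := 0) (by norm_num) (by norm_num)
  refine Exec.mono (.seq_free <| h.assign v (by norm_num) ?_ ?_ ?_ fun c₁ =>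
    .seq_free <| c₁.assign 0 (by norm_num) ?_ rfl h0 fun c₂ =>
    .seq_free <| c₂.assign 0 (by norm_num) ?_ rfl h0 fun c₃ =>
    .seq_free <| c₃.assign 0 (by norm_num) ?_ rfl h0 fun c₄ =>
    .mono (.loop (I := fun j s' => E.Ctx s' ∧ s.Agree 14 s' ∧ s'.mem = s.mem ∧
      s'.reg 14 = quo (coeffNorm α) (2 ^ E.d) v j ∧
      s'.reg 15 = hiCode (coeffNorm α) (2 ^ E.d) v j ∧
      s'.reg 16 = loNorm (coeffNorm α) (2 ^ E.d) v j ∧ s'.reg 17 = j) (τ := 50) (c := 0) E.d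
      ?_ ?_ ⟨c₄, ?_, rfl, ?_, ?_, ?_, ?_⟩) le_rfl fun s' h => ⟨h.1, h.2.1, h.2.2.1, h.2.2.2.2.1,
        h.2.2.2.2.2.1⟩) ?_ fun _ h => h
  · simp [Feasible, ConstLE, Expr.cost]
  · simp [Expr.eval, BinOp.eval, hmem, h.reg1, hv]; ring
  · rwa [abs_of_nonneg hv0]
  · simp [Feasible, ConstLE, Expr.cost]
  · simp [Feasible, ConstLE, Expr.cost]
  · simp [Feasible, ConstLE, Expr.cost]
  · rintro j - s₁ ⟨hc, -, -, -, -, -, h17⟩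
    refine ⟨fits hc.bounded (by simp [Feasible, ConstLE, Expr.cost]), ?_⟩
    simp [Expr.eval, BinOp.eval, h17, hc.reg2]
  · rintro j hj s₁ ⟨hc, ha, hm, h14, h15, h16', h17⟩
    exact (hc.exec_digitStep hv0 hvM hj h14 h15 h16' h17).mono le_rfl
      fun s' ⟨g₁, g₂, g₃, g₄⟩ => ⟨g₁, ha.trans g₂, g₃.trans hm, g₄⟩
  · exact ((((State.Agree.refl _ _).setReg (by norm_num) _).setReg (by norm_num) _).setReg
      (by norm_num) _).setReg (by norm_num) _
  · simp [State.reg_setReg_of_ne, quo]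
  · simp [State.reg_setReg_of_ne, hiCode]
  · simp [State.reg_setReg_of_ne, loNorm]
  · simp
  · simp [Expr.cost]
    omega

end Env

end ReductionData

/-! ### Writing one query into memory -/

namespace ReductionData

open WordRAM Expr Program

variable {α : Fin 3 → ℤ} {R : ReductionData α}

namespace Env

variable {E : R.Env} {s : State}

/-- The query that is being built is `buf` so far. -/
def Buf (E : R.Env) (s : State) (buf : List ℤ) : Prop :=
  s.reg 9 = buf.length ∧ s.segment (3 * E.n) buf.length = buf

theorem Buf.congr {buf : List ℤ} (h : E.Buf s buf) {s' : State} (hr : s'.reg 9 = s.reg 9)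
    (hm : s'.mem = s.mem) : E.Buf s' buf := by
  refine ⟨hr.trans h.1, ?_⟩
  conv_rhs => rw [← h.2]
  simp [State.segment_eq_map, hm]

theorem Buf.append {buf : List ℤ} (h : E.Buf s buf) (w : ℤ) :
    E.Buf ((s.setMem (3 * E.n + buf.length) w).setReg 9 (buf.length + 1 : ℕ)) (buf ++ [w]) := by
  refine ⟨by simp, ?_⟩
  rw [List.length_append, List.length_singleton, State.segment_setReg, State.segment_setMem, h.2]

theorem shiftExpr_eval (hs : E.Ctx s) (j : Fin 4) :
    (R.shiftExpr j).eval s = R.γ j * R.gap E.n := by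
  simp [shiftExpr, succSize, Expr.eval, BinOp.eval, hs.reg1, R.shift_eq]

theorem one_le_M (E : R.Env) : 1 ≤ E.M := by linarith [E.two_le]

theorem length_le_M {m : ℕ} (h : m ≤ E.N) : |(m : ℤ)| ≤ (E.M : ℤ) := by
  rw [abs_of_nonneg (by positivity)]
  exact le_trans (by exact_mod_cast h) E.N_le

/-- Appending a word to the query. -/
theorem Ctx.exec_append (h : E.Ctx s) {buf : List ℤ} (hb : E.Buf s buf) (hlen : buf.length < E.N)
    {e : Expr} (he : e.Feasible E.M) {w : ℤ} (hw : e.eval s = w) (hwM : |w| ≤ E.M) :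
    Exec (LDT1 α 0) E.W E.N
      (.seq (.store (add (reg 0) (reg 9)) e) (.assign 9 (add (reg 9) (const 1)))) s
      (e.cost + 8) 0 fun s' =>
        E.Ctx s' ∧ E.Buf s' (buf ++ [w]) ∧ s.Agree 9 s' ∧ ∀ i, 9 < i → s'.reg i = s.reg i := by
  have h1 := E.one_le_M
  have haddr : (add (reg 0) (reg 9)).eval s = 3 * E.n + buf.length := by
    simp [Expr.eval, BinOp.eval, h.reg0, hb.1]
  refine Exec.mono (.seq_free (τ' := (add (reg 9) (const 1)).cost + 1) <|
    .store (fits h.bounded ?_) (fits h.bounded he) ?_) ?_ fun _ h => h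
  · simp [Feasible, ConstLE, Expr.cost]
  · rw [haddr, hw]
    refine (h.setMem hwM).assign (buf.length + 1 : ℕ) (by norm_num) ?_ ?_ (length_le_M hlen)
      fun c => ⟨c, hb.append w, ?_, fun i hi => ?_⟩
    · simp [Feasible, ConstLE, Expr.cost, h1]
    · simp [Expr.eval, BinOp.eval, hb.1]
    · exact ((State.Agree.refl _ _).setMem _ _).setReg le_rfl _
    · rw [State.reg_setReg_of_ne _ _ (by omega), State.reg_setMem]
  · simp [Expr.cost]
    omega

/-- The conditional append is expressed as filtering a singleton list, so that the steps of the loop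
combine by concatenation. -/
theorem Ctx.exec_selectStep (h : E.Ctx s) {buf : List ℤ} (hb : E.Buf s buf)
    (hlen : buf.length < E.N) (i : Fin 3) {a : ℕ} (ha : a < E.n)
    (h10 : s.reg 10 = ((i : ℕ) * E.n + a : ℕ)) {p : ℤ} (h12 : s.reg 12 = p) :
    Exec (LDT1 α 0) E.W E.N (R.selectStep i.castSucc) s (150 * (E.d + 1)) 0 fun s' =>
      E.Ctx s' ∧ E.Buf s' (buf ++ (colourClass (coeffNorm α) (2 ^ E.d) E.d E.n p
        [(E.L i)[a]'((E.length_eq i).symm ▸ ha)]).map (· + R.γ i.castSucc * R.gap E.n)) ∧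
      s.Agree 9 s' ∧ s'.reg 10 = ((i : ℕ) * E.n + (a + 1) : ℕ) ∧ s'.reg 11 = s.reg 11 ∧
      s'.reg 12 = s.reg 12 ∧ s'.reg 13 = s.reg 13 := by
  have h1 := E.one_le_M
  set x := (E.L i)[a]'((E.length_eq i).symm ▸ ha) with hx
  have hxL : x ∈ E.L i := List.getElem_mem _
  have hmem : s.mem (s.reg 10) = x := by
    rw [h10, hx, ← h.input i a ha]
    push_cast
    rfl
  have hz := E.shiftCoeff_le i.castSucc
  have hidx : (i : ℕ) * E.n + (a + 1) ≤ E.N := by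
    have : (i : ℕ) * E.n ≤ 2 * E.n := Nat.mul_le_mul_right _ (by omega)
    have := E.three_n_le
    omega
  refine Exec.mono (.seq_free <| (h.exec_colourProgram hxL hmem).mono le_rfl
    fun s₁ ⟨c₁, a₁, m₁, e15, e16⟩ => .seq_free <| Exec.mono (Post := fun s' =>
      E.Ctx s' ∧ E.Buf s' (buf ++ (colourClass (coeffNorm α) (2 ^ E.d) E.d E.n p [x]).map
        (· + R.γ i.castSucc * R.gap E.n)) ∧ s.Agree 9 s' ∧ ∀ i, 9 < i → i < 14 →
        s'.reg i = s.reg i) (.ite (τ := 30) (fits c₁.bounded ?_) ?_ ?_) le_rfl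
    fun s₂ ⟨c₂, b₂, a₂, e₂⟩ => c₂.assign ((i : ℕ) * E.n + (a + 1) : ℕ) (by norm_num) ?_ ?_
      (length_le_M hidx) fun c₃ => ⟨c₃, b₂.congr ?_ rfl, a₂.setReg (by norm_num) _, ?_, ?_, ?_, ?_⟩)
    ?_ fun _ h => h
  · simp [Feasible, ConstLE, Expr.cost, h1]
  · intro hc
    have b₁ : E.Buf s₁ buf := hb.congr (a₁ 9 (by norm_num)) m₁
    have hcol : colour (coeffNorm α) (2 ^ E.d) (x + (E.n : ℤ) ^ 3) E.d = p := by
      rw [← h12, ← a₁ 12 (by norm_num), colour]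
      simpa [Expr.eval, BinOp.eval, c₁.reg2, c₁.reg3, e15, e16] using hc
    refine (c₁.exec_append b₁ hlen (w := x + R.γ i.castSucc * R.gap E.n) ?_ ?_ ?_).mono ?_
      fun s₂ ⟨c₂, b₂, a₂, e₂⟩ => ⟨c₂, ?_, (a₁.mono (by norm_num)).trans a₂, fun j h₁ h₂ => ?_⟩
    · simp [Feasible, ConstLE, Expr.cost, shiftExpr, succSize, hz, h1]
    · have hs := shiftExpr_eval c₁ i.castSucc
      simp only [Expr.eval, BinOp.eval] at hs ⊢
      rw [hs, m₁, a₁ 10 (by norm_num), hmem]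
    · exact (R.shift_bound E.n ((E.bound i x hxL).trans (R.cube_le_radius E.n))).trans
        E.queryLen_le
    · simp [Expr.cost, shiftExpr, succSize]
    · simpa [colourClass, hcol] using b₂
    · rw [e₂ j h₁, a₁ j h₂]
  · intro hc
    have hcol : ¬colour (coeffNorm α) (2 ^ E.d) (x + (E.n : ℤ) ^ 3) E.d = p := by
      rw [← h12, ← a₁ 12 (by norm_num), colour]
      simpa [Expr.eval, BinOp.eval, c₁.reg2, c₁.reg3, e15, e16] using hc
    refine Exec.mono (.skip ⟨c₁, ?_, a₁.mono (by norm_num), fun j _ h₂ => a₁ j h₂⟩) (by norm_num)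
      fun _ h => h
    simpa [colourClass, hcol] using hb.congr (a₁ 9 (by norm_num)) m₁
  · simp [Feasible, ConstLE, Expr.cost, h1]
  · simp [Expr.eval, BinOp.eval, e₂, h10]
    ring
  · simp [Expr.cost]
    omega
  · simp [State.reg_setReg_of_ne]
  · simp
  · simp [State.reg_setReg_of_ne, e₂]
  · simp [State.reg_setReg_of_ne, e₂]
  · simp [State.reg_setReg_of_ne, e₂]

theorem Ctx.exec_selectProgram (h : E.Ctx s) {buf : List ℤ} (hb : E.Buf s buf) (i : Fin 3)
    (hlen : buf.length ≤ (i : ℕ) * E.n) {t : ℤ} (ht₀ : 0 ≤ t) (ht : t ≤ E.M)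
    (h10 : s.reg 10 = ((i : ℕ) * E.n : ℕ)) (h11 : s.reg 11 = t)
    (h13 : s.reg 13 = ((i : ℕ) * E.n : ℕ)) :
    Exec (LDT1 α 0) E.W E.N (R.selectProgram i.castSucc) s (200 * ((E.d + 1) * (E.n + 1))) 0
      fun s' =>
        E.Ctx s' ∧ E.Buf s' (buf ++ (colourClass (coeffNorm α) (2 ^ E.d) E.d E.n (t % E.k)
          (E.L i)).map (· + R.γ i.castSucc * R.gap E.n)) ∧
        s.Agree 9 s' ∧ s'.reg 10 = ((i + 1 : ℕ) * E.n : ℕ) ∧ s'.reg 11 = t / E.k ∧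
        s'.reg 13 = ((i + 1 : ℕ) * E.n : ℕ) := by
  have hk := E.k_pos
  have hidx : (i + 1 : ℕ) * E.n ≤ E.N := by
    have : (i + 1 : ℕ) * E.n ≤ 3 * E.n := Nat.mul_le_mul_right _ (by omega)
    exact this.trans E.three_n_le
  have hcls (a : ℕ) : (colourClass (coeffNorm α) (2 ^ E.d) E.d E.n (t % E.k)
      ((E.L i).take a)).length ≤ a :=
    (List.length_filter_le _ _).trans (List.length_take_le _ _)
  have hdiv : |t / E.k| ≤ (E.M : ℤ) := by
    rw [abs_of_nonneg (Int.ediv_nonneg ht₀ (by linarith))]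
    exact (Int.ediv_le_self _ ht₀).trans ht
  refine Exec.mono (.seq_free <| h.assign (t % E.k) (by norm_num) ?_ ?_ ?_ fun c₁ =>
    .seq_free <| c₁.assign (t / E.k) (by norm_num) ?_ ?_ hdiv fun c₂ =>
    .seq_free <| c₂.assign ((i + 1 : ℕ) * E.n : ℕ) (by norm_num) ?_ ?_ (length_le_M hidx) fun c₃ =>
    .mono (.loop (I := fun a s' => E.Ctx s' ∧ E.Buf s' (buf ++ (colourClass (coeffNorm α) (2 ^ E.d)
        E.d E.n (t % E.k) ((E.L i).take a)).map (· + R.γ i.castSucc * R.gap E.n)) ∧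
        s.Agree 9 s' ∧ s'.reg 10 = ((i : ℕ) * E.n + a : ℕ) ∧ s'.reg 11 = t / E.k ∧
        s'.reg 12 = t % E.k ∧ s'.reg 13 = ((i + 1 : ℕ) * E.n : ℕ))
        (τ := 150 * (E.d + 1)) (c := 0) E.n ?_ ?_ ⟨c₃, ?_, ?_, ?_, ?_, ?_, ?_⟩) le_rfl
      fun s' ⟨c, b, a, e10, e11, e12, e13⟩ => ⟨c, ?_, a, ?_, e11, e13⟩) ?_ fun _ h => h
  · simp [Feasible, ConstLE, Expr.cost]
  · simp [Expr.eval, BinOp.eval, h11, h.reg6]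
  · rw [abs_of_nonneg (Int.emod_nonneg _ (by linarith))]
    exact (Int.emod_lt_of_pos _ (by linarith)).le.trans E.k_le
  · simp [Feasible, ConstLE, Expr.cost]
  · simp [Expr.eval, BinOp.eval, State.reg_setReg_of_ne, h11, h.reg6]
  · simp [Feasible, ConstLE, Expr.cost]
  · simp [Expr.eval, BinOp.eval, State.reg_setReg_of_ne, h13, h.reg1]
    ring
  · rintro a - s₁ ⟨hc, -, -, e10, -, -, e13⟩
    refine ⟨fits hc.bounded (by simp [Feasible, ConstLE, Expr.cost]), ?_⟩
    simp only [Expr.eval, BinOp.eval, e10, e13]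
    simp only [ne_eq, ite_eq_right_iff, one_ne_zero, imp_false, not_not, Nat.cast_lt]
    rw [add_mul]
    omega
  · rintro a ha s₁ ⟨hc, hb₁, ha₁, e10, e11, e12, e13⟩
    refine (hc.exec_selectStep hb₁ ?_ i ha e10 e12).mono le_rfl
      fun s' ⟨g₁, g₂, g₃, g₄, g₅, g₆, g₇⟩ =>
        ⟨g₁, ?_, ha₁.trans g₃, g₄, g₅.trans e11, g₆.trans e12, g₇.trans e13⟩
    · have := hcls a
      simp only [List.length_append, List.length_map]
      rw [add_mul] at hidx
      omega
    -- The first `a + 1` elements are the first `a` and one more; filtering and shifting commute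
    -- with concatenation.
    · have ha' : a < (E.L i).length := (E.length_eq i).symm ▸ ha
      rwa [List.append_assoc, ← List.map_append, colourClass, colourClass, ← List.filter_append,
        List.take_append_getElem ha'] at g₂
  · simp only [List.take_zero, colourClass, List.filter_nil, List.map_nil, List.append_nil]
    exact hb.congr (by simp [State.reg_setReg_of_ne]) rfl
  · exact (((State.Agree.refl _ _).setReg (by norm_num) _).setReg (by norm_num) _).setReg
      (by norm_num) _
  · simpa [State.reg_setReg_of_ne] using h10
  · simp [State.reg_setReg_of_ne]
  · simp [State.reg_setReg_of_ne]
  · simp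
  · simp only [Expr.cost]
    nlinarith
  · rwa [List.take_of_length_le (E.length_eq i).le] at b
  · rw [e10, add_mul, one_mul]

theorem padExpr_eval (h : E.Ctx s) {a : ℕ} (h9 : s.reg 9 = a) :
    R.padExpr.eval s = R.pad E.n a + R.γ 3 * R.gap E.n := by
  have hs := shiftExpr_eval h 3
  simp only [padExpr, Expr.eval, BinOp.eval, succSize, h9, h.reg1] at hs ⊢
  rw [hs, pad, padValue, padCoeff, padCoeff', U]
  ring

theorem queryLenExpr_eval (h : E.Ctx s) : R.queryLenExpr.eval s = E.N := by
  simp only [queryLenExpr, succSize, Expr.eval, BinOp.eval, h.reg1, N, cast_queryLen, U]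
  ring

theorem abs_scale_le (E : R.Env) : |R.K| ≤ (E.M : ℤ) := by
  have := R.four_le_scale
  rw [abs_of_pos R.scale_pos]
  nlinarith [E.scale_sq_le]

theorem queryLenExpr_feasible (E : R.Env) : R.queryLenExpr.Feasible E.M := by
  have h1 := E.one_le_M
  have := E.scale_sq_le
  simpa [queryLenExpr, succSize, Feasible, ConstLE, Expr.cost, h1] using this

theorem padExpr_feasible (E : R.Env) : R.padExpr.Feasible E.M := by
  have h1 := E.one_le_M
  have hK := E.abs_scale_le
  have hz := E.shiftCoeff_le 3
  have hS := R.coeffNorm_pos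
  have hK₀ := R.scale_pos
  have h₂ : |R.padCoeff| ≤ (E.M : ℤ) := by
    rw [abs_of_nonneg (by rw [padCoeff]; positivity)]; exact E.padCoeff_le
  have h₃ : |R.padCoeff'| ≤ (E.M : ℤ) := by
    rw [abs_of_nonneg (by rw [padCoeff']; positivity)]; exact E.padCoeff'_le
  simp [padExpr, shiftExpr, succSize, Feasible, ConstLE, Expr.cost, h1, hK, hz, h₂, h₃]

theorem Ctx.exec_padProgram (h : E.Ctx s) {buf : List ℤ} (hb : E.Buf s buf)
    (hlen : buf.length ≤ E.N) :
    Exec (LDT1 α 0) E.W E.N R.padProgram s (200 * E.N + 20) 0 fun s' =>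
      E.Ctx s' ∧ E.Buf s' (buf ++ (R.padding E.n buf.length (E.N - buf.length)).map
        (· + R.γ 3 * R.gap E.n)) ∧ s.Agree 9 s' := by
  refine Exec.mono (.loop (I := fun a s' => E.Ctx s' ∧ E.Buf s' (buf ++
    (R.padding E.n buf.length a).map (· + R.γ 3 * R.gap E.n)) ∧ s.Agree 9 s') (τ := 100) (c := 0)
    (E.N - buf.length) ?_ ?_ ⟨h, ?_, .refl _ _⟩) ?_ fun _ h => h
  · rintro a ha s₁ ⟨hc, hb₁, -⟩
    refine ⟨fits hc.bounded ?_, ?_⟩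
    · have := E.queryLenExpr_feasible
      exact ⟨⟨trivial, this.1⟩, by simp [queryLenExpr, succSize, Expr.cost]⟩
    · have h9 := hb₁.1
      simp only [Expr.eval, BinOp.eval, queryLenExpr_eval hc, h9, padding, List.length_append,
        List.length_map, List.length_range']
      simp only [ne_eq, ite_eq_right_iff, one_ne_zero, imp_false, not_not, Nat.cast_lt]
      omega
  · rintro a ha s₁ ⟨hc, hb₁, ha₁⟩
    have hlen₁ : (buf ++ (R.padding E.n buf.length a).map (· + R.γ 3 * R.gap E.n)).length
        = buf.length + a := by
      simp [padding]
    have hlt : buf.length + a < E.N := by omega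
    have hlt' : ((buf.length + a : ℕ) : ℤ) < R.K * R.U E.n := by
      rw [← R.cast_queryLen]
      exact_mod_cast hlt
    refine (hc.exec_append hb₁ (hlen₁ ▸ hlt) E.padExpr_feasible
      (padExpr_eval hc (a := buf.length + a) (by rw [hb₁.1, hlen₁])) ?_).mono ?_
      fun s' ⟨g₁, g₂, g₃, _⟩ => ⟨g₁, ?_, ha₁.trans g₃⟩
    · refine le_trans (R.shift_bound E.n ?_) E.queryLen_le
      rw [pad, abs_of_nonneg (padValue_nonneg R.coeffNorm_pos.le R.scale_pos (R.scale_le_U _)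
        (by positivity) hlt')]
      exact (padValue_lt R.three_le R.scale_pos (R.scale_le_U _) (by positivity) hlt').le
    · simp [padExpr, shiftExpr, succSize, Expr.cost]
    · rw [padding, List.range'_concat, List.map_append, List.map_append, ← List.append_assoc]
      simpa [padding] using g₂
  · simpa [padding] using hb
  · simp only [Expr.cost, queryLenExpr, succSize]
    omega

end Env

end ReductionData

/-! ### One round, the setup, and the whole program -/

namespace ReductionData

open WordRAM Expr Program

variable {α : Fin 3 → ℤ} {R : ReductionData α}

namespace Env

variable {E : R.Env} {s : State}

/-- The query with number `t` has a solution. -/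
def QueryYes (E : R.Env) (t : ℕ) : Prop :=
  ∃ w : Fin 3 → ℤ, Function.Injective w ∧
    (∀ i, w i ∈ R.queryList (2 ^ E.d) E.d E.n E.L (wanted E.k t)) ∧ ∑ i, α i * w i = 0

/-- The query with number `t`, as an instance of the one-partite problem. -/
def queryInst (E : R.Env) (t : ℕ) : OnePartiteInst where
  X := (R.queryList (2 ^ E.d) E.d E.n E.L (wanted E.k t)).toFinset
  bound x hx := by
    rw [List.toFinset_card_of_nodup (R.nodup_queryList E.length_eq E.bound E.nodup),
      R.length_queryList E.length_eq]
    exact R.queryList_bound E.length_eq E.bound (List.mem_toFinset.1 hx)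

theorem size_queryInst (t : ℕ) : (LDT1 α 0).size (E.queryInst t) = E.N :=
  (List.toFinset_card_of_nodup (R.nodup_queryList E.length_eq E.bound E.nodup)).trans
    (R.length_queryList E.length_eq)

theorem encodes_queryInst (t : ℕ) : (LDT1 α 0).Encodes (E.queryInst t)
    (R.queryList (2 ^ E.d) E.d E.n E.L (wanted E.k t)) :=
  ⟨R.nodup_queryList E.length_eq E.bound E.nodup, fun _ => List.mem_toFinset.symm⟩

theorem yes_queryInst (t : ℕ) : (LDT1 α 0).Yes (E.queryInst t) ↔ E.QueryYes t := by
  simp [LDT1, queryInst, QueryYes]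

/-- The left side is the memory content in the exact shape left by the three selection loops and the
padding loop. -/
theorem queryList_eq (E : R.Env) (t : ℤ) :
    let buf := [] ++ (colourClass (coeffNorm α) (2 ^ E.d) E.d E.n (t % E.k) (E.L 0)).map
        (· + R.γ (Fin.castSucc 0) * R.gap E.n) ++
      (colourClass (coeffNorm α) (2 ^ E.d) E.d E.n (t / E.k % E.k) (E.L 1)).map
        (· + R.γ (Fin.castSucc 1) * R.gap E.n) ++
      (colourClass (coeffNorm α) (2 ^ E.d) E.d E.n (t / E.k / E.k % E.k) (E.L 2)).map
        (· + R.γ (Fin.castSucc 2) * R.gap E.n)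
    buf ++ (R.padding E.n buf.length (E.N - buf.length)).map (· + R.γ 3 * R.gap E.n)
      = R.queryList (2 ^ E.d) E.d E.n E.L (wanted E.k t) := by
  simp [queryList, shiftedConcat, parts, selected, selectedLen, wanted, N, add_assoc]

/-- The word `z` is the truth value of `A`. -/
def IsTruthValue (z : ℤ) (A : Prop) : Prop := (A → z = 1) ∧ (¬A → z = 0)

theorem isTruthValue_iff {z : ℤ} {A : Prop} [Decidable A] :
    IsTruthValue z A ↔ z = if A then 1 else 0 := by
  by_cases h : A <;> simp [IsTruthValue, h]

open Classical in
theorem Ctx.exec_queryProgram (h : E.Ctx s) {t : ℕ} (ht : (t : ℤ) < E.k ^ 3)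
    (h7 : s.reg 7 = t) {A : Prop} (h8 : IsTruthValue (s.reg 8) A) :
    Exec (LDT1 α 0) E.W E.N R.queryProgram s (1000 * ((E.d + 1) * E.N)) 1 fun s' =>
      E.Ctx s' ∧ s'.reg 7 = (t + 1 : ℕ) ∧ IsTruthValue (s'.reg 8) (A ∨ E.QueryYes t) := by
  rw [isTruthValue_iff] at h8
  have hk := E.k_pos
  have h1 := E.one_le_M
  have h0 := abs_const_le (E := E) (z := 0) (by norm_num) (by norm_num)
  have h1' := abs_const_le (E := E) (z := 1) (by norm_num) (by norm_num)
  have ht₀ : (0 : ℤ) ≤ t := by positivity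
  have htM : (t : ℤ) ≤ E.M := ht.le.trans E.count_le
  have ht₁ : 0 ≤ (t : ℤ) / E.k := Int.ediv_nonneg ht₀ (by linarith)
  have htM₁ : (t : ℤ) / E.k ≤ E.M := (Int.ediv_le_self _ ht₀).trans htM
  have ht₂ : 0 ≤ (t : ℤ) / E.k / E.k := Int.ediv_nonneg ht₁ (by linarith)
  have htM₂ : (t : ℤ) / E.k / E.k ≤ E.M := (Int.ediv_le_self _ ht₁).trans htM₁
  have hcls (i : Fin 3) (p : ℤ) :
      (colourClass (coeffNorm α) (2 ^ E.d) E.d E.n p (E.L i)).length ≤ E.n :=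
    (List.length_filter_le _ _).trans (E.length_eq i).le
  have hN := E.queryLen_pos
  have hnN : E.n + 1 ≤ E.N := R.succ_le_queryLen E.n
  have h3n := E.three_n_le
  have hfeas := E.queryLenExpr_feasible
  refine Exec.mono (.seq_free <| h.assign 0 (by norm_num) ?_ rfl h0 fun c₁ =>
    .seq_free <| c₁.assign 0 (by norm_num) ?_ rfl h0 fun c₂ =>
    .seq_free <| c₂.assign t (by norm_num) ?_ ?_ ?_ fun c₃ =>
    .seq_free <| c₃.assign 0 (by norm_num) ?_ rfl h0 fun c₄ =>
    .seq_free <| (c₄.exec_selectProgram (buf := []) ⟨?_, ?_⟩ 0 ?_ ht₀ htM ?_ ?_ ?_).mono le_rfl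
      fun s₅ ⟨c₅, b₅, a₅, e10, e11, e13⟩ =>
    .seq_free <| (c₅.exec_selectProgram b₅ 1 ?_ ht₁ htM₁ e10 e11 e13).mono le_rfl
      fun s₆ ⟨c₆, b₆, a₆, e10, e11, e13⟩ =>
    .seq_free <| (c₆.exec_selectProgram b₆ 2 ?_ ht₂ htM₂ e10 e11 e13).mono le_rfl
      fun s₇ ⟨c₇, b₇, a₇, _, _, _⟩ =>
    .seq_free <| (c₇.exec_padProgram b₇ ?_).mono le_rfl fun s₈ ⟨c₈, b₈, a₈⟩ =>
    Exec.seq (c := 1) (c' := 0) (Exec.mono (Post := fun s₉ => E.Ctx s₉ ∧ s₉.reg 7 = t ∧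
      s₉.reg 8 = (if A then 1 else 0) ∧ s₉.reg 14 = if E.QueryYes t then 1 else 0)
      (.query (y := E.queryInst t) (fits c₈.bounded ?_) (fits c₈.bounded hfeas)
        (queryLenExpr_eval c₈) ?_ (size_queryInst t) (fun hy => ?_) fun hy => ?_) le_rfl
      fun s₉ ⟨c₉, e7, e8, e14⟩ => .seq_free <|
        c₉.assign (if A ∨ E.QueryYes t then 1 else 0) (by norm_num) ?_ ?_ ?_ fun c₁₀ =>
        c₁₀.assign (t + 1 : ℕ) (by norm_num) ?_ ?_ ?_ fun c₁₁ => ⟨c₁₁, ?_, ?_⟩)) ?_ fun _ h => h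
  · simp [Feasible, ConstLE, Expr.cost]
  · simp [Feasible, ConstLE, Expr.cost]
  · simp [Feasible, ConstLE, Expr.cost]
  · simp [Expr.eval, State.reg_setReg_of_ne, h7]
  · rwa [abs_of_nonneg ht₀]
  · simp [Feasible, ConstLE, Expr.cost]
  · simp [State.reg_setReg_of_ne]
  · simp [State.segment_eq_map]
  · simp
  · simp [State.reg_setReg_of_ne]
  · simp [State.reg_setReg_of_ne]
  · simp
  · simpa using hcls 0 _
  · have h₀ := hcls 0 (t % E.k)
    have h₁ := hcls 1 (t / E.k % E.k)
    simp only [List.nil_append, List.length_append, List.length_map]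
    norm_num
    omega
  · have h₀ := hcls 0 (t % E.k)
    have h₁ := hcls 1 (t / E.k % E.k)
    have h₂ := hcls 2 (t / E.k / E.k % E.k)
    simp only [List.nil_append, List.length_append, List.length_map]
    omega
  · simp [Feasible, ConstLE, Expr.cost]
  · have b₉ : E.Buf s₈ (R.queryList (2 ^ E.d) E.d E.n E.L (wanted E.k t)) := by
      rw [← queryList_eq]
      exact b₈
    have hseg := b₉.2
    rw [R.length_queryList E.length_eq] at hseg
    rw [show eval s₈ (reg 0) = 3 * E.n from c₈.reg0, N, hseg]
    exact E.encodes_queryInst t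
  · have hy' := (yes_queryInst t).1 hy
    -- Building the query touches only registers from `9` on, so the counter and the accumulated
    -- answer survive.
    have ha := ((((((((State.Agree.refl 9 s).setReg le_rfl 0).setReg (by norm_num : 9 ≤ 10) 0).setReg
      (by norm_num : 9 ≤ 11) (t : ℤ)).setReg (by norm_num : 9 ≤ 13) 0).trans a₅).trans a₆).trans
      a₇).trans a₈
    refine ⟨c₈.setReg (by norm_num) h1', ?_, ?_, ?_⟩
    · rw [State.reg_setReg_of_ne _ _ (by norm_num), ha 7 (by norm_num), h7]
    · rw [State.reg_setReg_of_ne _ _ (by norm_num), ha 8 (by norm_num), h8]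
    · simp [hy']
  · have hy' := (yes_queryInst t).not.1 hy
    have ha := ((((((((State.Agree.refl 9 s).setReg le_rfl 0).setReg (by norm_num : 9 ≤ 10) 0).setReg
      (by norm_num : 9 ≤ 11) (t : ℤ)).setReg (by norm_num : 9 ≤ 13) 0).trans a₅).trans a₆).trans
      a₇).trans a₈
    refine ⟨c₈.setReg (by norm_num) h0, ?_, ?_, ?_⟩
    · rw [State.reg_setReg_of_ne _ _ (by norm_num), ha 7 (by norm_num), h7]
    · rw [State.reg_setReg_of_ne _ _ (by norm_num), ha 8 (by norm_num), h8]
    · simp [hy']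
  · simp [Feasible, ConstLE, Expr.cost]
  · simp only [Expr.eval, BinOp.eval, e8, e14]
    by_cases hA : A <;> by_cases hy : E.QueryYes t <;> simp [hA, hy]
  · split_ifs <;> assumption
  · simp [Feasible, ConstLE, Expr.cost, h1]
  · simp [Expr.eval, BinOp.eval, State.reg_setReg_of_ne, e7]
  · rw [abs_of_nonneg (by positivity)]
    push_cast
    linarith [E.count_le, show E.k ^ 3 = colourCount (coeffNorm α) (2 ^ E.d) E.d ^ 3 from rfl]
  -- Three selections cost `200 * (d + 1) * (n + 1)` each, the padding and the call `O(N)`, and `n +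
  -- 1 ≤ N`.
  · simp only [Expr.cost, queryLenExpr, succSize]
    nlinarith
  · simp
  · rw [isTruthValue_iff]
    simp [State.reg_setReg_of_ne]

theorem exec_assign {r : ℕ} {e : Expr} {Post : State → Prop} (h : s.Bounded E.M) (v : ℤ)
    (he : e.Feasible E.M) (hv : e.eval s = v) (hb : |v| ≤ (E.M : ℤ))
    (hPost : (s.setReg r v).Bounded E.M → Post (s.setReg r v)) :
    Exec (LDT1 α 0) E.W E.N (.assign r e) s (e.cost + 1) 0 Post :=
  .assign (fits h he) (hv ▸ hPost (h.setReg hb))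

/-- One step of the search for the number of digits. -/
theorem exec_setupStep (h : s.Bounded E.M) {j : ℕ} (hj : j + 1 ≤ E.d) (h2 : s.reg 2 = j)
    (h3 : s.reg 3 = 2 ^ j) (h4 : s.reg 4 = 2 ^ (j * j)) (h5 : s.reg 5 = coeffNorm α ^ j) :
    Exec (LDT1 α 0) E.W E.N (setupStep (coeffNorm α)) s 50 0 fun s' =>
      s'.Bounded E.M ∧ s'.mem = s.mem ∧ (∀ i, i < 2 ∨ 5 < i → s'.reg i = s.reg i) ∧
        s'.reg 2 = (j + 1 : ℕ) ∧ s'.reg 3 = 2 ^ (j + 1) ∧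
        s'.reg 4 = 2 ^ ((j + 1) * (j + 1)) ∧ s'.reg 5 = coeffNorm α ^ (j + 1) := by
  have h1 := E.one_le_M
  have h2M := E.two_le
  have hS := E.abs_coeffNorm_le
  have hdM : (E.d : ℤ) ≤ E.M := E.d_le.trans E.k_le
  have hpow : (2 : ℤ) ^ ((j + 1) * (j + 1)) ≤ E.M :=
    (pow_le_pow_right₀ (by norm_num) (Nat.mul_le_mul hj hj)).trans E.pow_sq_le
  have hpow' : (2 : ℤ) ^ (j + 1) ≤ E.M :=
    (pow_le_pow_right₀ (by norm_num) (Nat.le_mul_self _)).trans hpow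
  have hSpow : coeffNorm α ^ (j + 1) ≤ E.M :=
    (pow_le_pow_right₀ (by linarith [R.three_le]) hj).trans (E.S_pow_le.trans E.k_le)
  refine Exec.mono (.seq_free <| exec_assign h (2 ^ ((j + 1) * (j + 1))) ?_ ?_ ?_ fun c₁ =>
    .seq_free <| exec_assign c₁ (2 ^ (j + 1)) ?_ ?_ ?_ fun c₂ =>
    .seq_free <| exec_assign c₂ (coeffNorm α ^ (j + 1)) ?_ ?_ ?_ fun c₃ =>
    exec_assign c₃ (j + 1 : ℕ) ?_ ?_ ?_ fun c₄ => ⟨c₄, ?_, ?_, ?_, ?_, ?_, ?_⟩) ?_ fun _ h => h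
  · simp [Feasible, ConstLE, Expr.cost, h2M]
  · simp only [Expr.eval, BinOp.eval, h3, h4]
    ring
  · rwa [abs_of_nonneg (by positivity)]
  · simp [Feasible, ConstLE, Expr.cost, h2M]
  · simp [Expr.eval, BinOp.eval, State.reg_setReg_of_ne, h3, pow_succ]
  · rwa [abs_of_nonneg (by positivity)]
  · simp [Feasible, ConstLE, Expr.cost, hS]
  · simp [Expr.eval, BinOp.eval, State.reg_setReg_of_ne, h5, pow_succ]
  · rwa [abs_of_nonneg (pow_pos R.coeffNorm_pos _).le]
  · simp [Feasible, ConstLE, Expr.cost, h1]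
  · simp [Expr.eval, BinOp.eval, State.reg_setReg_of_ne, h2]
  · rw [abs_of_nonneg (by positivity)]
    exact le_trans (by exact_mod_cast hj) hdM
  · simp [Expr.cost]
  · rfl
  · intro i hi
    rw [State.reg_setReg_of_ne _ _ (by omega), State.reg_setReg_of_ne _ _ (by omega),
      State.reg_setReg_of_ne _ _ (by omega), State.reg_setReg_of_ne _ _ (by omega)]
  all_goals simp [State.reg_setReg_of_ne]

theorem init_mem (i : Fin 3) {a : ℕ} (ha : a < E.n) :
    (State.init (E.L 0 ++ E.L 1 ++ E.L 2)).mem ((i : ℕ) * E.n + a)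
      = (E.L i)[a]'((E.length_eq i).symm ▸ ha) := by
  have h (i) := E.length_eq i
  have e : ((i : ℕ) * E.n + a : ℤ) = ((i : ℕ) * E.n + a : ℕ) := by push_cast; rfl
  rw [State.init, e]
  simp only [Int.natCast_nonneg, if_true, Int.toNat_natCast]
  fin_cases i
  · simp [List.getD, List.getElem?_append, h, ha]
  · simp [List.getD, List.getElem?_append, h, ha]
  · have h₁ : ¬2 * E.n + a < E.n := by omega
    have h₂ : ¬2 * E.n + a - E.n < E.n := by omega
    have h₃ : 2 * E.n + a - E.n - E.n = a := by omega
    simp [List.getD, List.getElem?_append, h, ha, h₁, h₂, h₃]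

theorem bounded_init : (State.init (E.L 0 ++ E.L 1 ++ E.L 2)).Bounded E.M := by
  have h3 : 3 * E.n ≤ E.N := E.three_n_le
  constructor
  · intro r
    simp only [State.init]
    split_ifs
    · refine length_le_M ?_
      simp only [List.length_append, E.length_eq]
      omega
    · simp
  · intro a
    simp only [State.init]
    split_ifs
    · rw [List.getD_eq_getElem?_getD]
      rcases hx : (E.L 0 ++ E.L 1 ++ E.L 2)[a.toNat]? with _ | x
      · simp
      · have hx := List.mem_of_getElem? hx
        have hle : (E.n : ℤ) ^ 3 ≤ E.M := by
          have : (0 : ℤ) ≤ (E.n : ℤ) ^ 3 := by positivity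
          linarith [E.two_cube_le]
        simp only [List.mem_append] at hx
        rcases hx with (hx | hx) | hx <;> exact (E.bound _ x hx).trans hle
    · simp

theorem exec_setupProgram (E : R.Env) :
    Exec (LDT1 α 0) E.W E.N (setupProgram (coeffNorm α)) (.init (E.L 0 ++ E.L 1 ++ E.L 2))
      (100 * (E.d + 1)) 0 fun s' => E.Ctx s' ∧ s'.reg 7 = 0 ∧ s'.reg 8 = 0 := by
  have h1 := E.one_le_M
  have h2M := E.two_le
  have h16 := E.sixteen_le
  have hS := E.abs_coeffNorm_le
  have h1' := abs_const_le (E := E) (z := 1) (by norm_num) (by norm_num)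
  have h2' := abs_const_le (E := E) (z := 2) (by norm_num) (by norm_num)
  have h3' := abs_const_le (E := E) (z := 3) (by norm_num) (by norm_num)
  have hd := E.one_le
  have h3 : 3 * E.n ≤ E.N := E.three_n_le
  set s := State.init (E.L 0 ++ E.L 1 ++ E.L 2) with hs
  have hreg0 : s.reg 0 = 3 * E.n := by
    simp [hs, State.init, E.length_eq]
    ring
  have hreg (i : ℕ) (hi : i ≠ 0) : s.reg i = 0 := by simp [hs, State.init, hi]
  refine Exec.mono (.seq_free <| exec_assign bounded_init E.n ?_ ?_ (length_le_M (by omega))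
    fun c₁ =>
    .seq_free <| exec_assign c₁ 1 ?_ rfl h1' fun c₂ =>
    .seq_free <| exec_assign c₂ 2 ?_ rfl h2' fun c₃ =>
    .seq_free <| exec_assign c₃ 2 ?_ rfl h2' fun c₄ =>
    .seq_free <| exec_assign c₄ (coeffNorm α) ?_ rfl hS fun c₅ =>
    -- After `j` iterations the registers describe `j + 1` digits, so the search takes `d - 1`
    -- iterations.
    .seq_free <| .mono (.loop (I := fun j s' => s'.Bounded E.M ∧ s'.mem = s.mem ∧
        s'.reg 0 = 3 * E.n ∧ s'.reg 1 = E.n ∧ s'.reg 7 = 0 ∧ s'.reg 8 = 0 ∧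
        s'.reg 2 = (j + 1 : ℕ) ∧ s'.reg 3 = 2 ^ (j + 1) ∧
        s'.reg 4 = 2 ^ ((j + 1) * (j + 1)) ∧ s'.reg 5 = coeffNorm α ^ (j + 1)) (τ := 50) (c := 0)
      (E.d - 1) ?_ ?_ ⟨c₅, rfl, ?_, ?_, ?_, ?_, ?_, ?_, ?_, ?_⟩) le_rfl
      fun s₆ ⟨c₆, m₆, e0, e1, e7, e8, e2, e3, e4, e5⟩ => exec_assign c₆ E.k ?_ ?_ ?_
      fun c₇ => ⟨⟨c₇, ?_, ?_, ?_, ?_, ?_, ?_⟩, ?_, ?_⟩) ?_ fun _ h => h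
  · simpa [Feasible, ConstLE, Expr.cost] using h3'
  · simp [Expr.eval, BinOp.eval, hreg0]
  · simpa [Feasible, ConstLE, Expr.cost] using h1
  · simpa [Feasible, ConstLE, Expr.cost] using h2M
  · simpa [Feasible, ConstLE, Expr.cost] using h2M
  · simpa [Feasible, ConstLE, Expr.cost] using hS
  · rintro j hj s₁ ⟨c, -, -, e1, -, -, -, -, e4, -⟩
    refine ⟨fits c (by simp [Feasible, ConstLE, Expr.cost, h1, h2M]), ?_⟩
    simp only [Expr.eval, BinOp.eval, e1, e4, ne_eq, ite_eq_right_iff, one_ne_zero, imp_false,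
      not_not]
    constructor
    · intro hlt
      by_contra hge
      have : j + 1 = E.d := by omega
      rw [this] at hlt
      linarith [E.lt_pow]
    · intro hlt
      linarith [E.minimal (j + 1) (by omega) (by omega)]
  · rintro j hj s₁ ⟨c, m, e0, e1, e7, e8, e2, e3, e4, e5⟩
    refine (exec_setupStep c (by omega) e2 e3 e4 e5).mono le_rfl
      fun s₂ ⟨c₂, m₂, a₂, f2, f3, f4, f5⟩ => ⟨c₂, m₂.trans m, ?_, ?_, ?_, ?_, f2, f3, f4, f5⟩
    · rw [a₂ 0 (by norm_num), e0]
    · rw [a₂ 1 (by norm_num), e1]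
    · rw [a₂ 7 (by norm_num), e7]
    · rw [a₂ 8 (by norm_num), e8]
  · simp [State.reg_setReg_of_ne, hreg0]
  · simp [State.reg_setReg_of_ne]
  · simp [State.reg_setReg_of_ne, hreg]
  · simp [State.reg_setReg_of_ne, hreg]
  · simp [State.reg_setReg_of_ne]
  · simp [State.reg_setReg_of_ne]
  · simp [State.reg_setReg_of_ne]
  · simp
  · simp [Feasible, ConstLE, Expr.cost, h1]
  · simp only [Expr.eval, BinOp.eval, e2, e3, e5, Nat.sub_add_cancel hd]
    rfl
  · rw [abs_of_nonneg (by linarith [E.k_pos])]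
    exact E.k_le
  · simp only [Expr.cost]
    omega
  · rw [State.reg_setReg_of_ne _ _ (by norm_num), e0]
  · rw [State.reg_setReg_of_ne _ _ (by norm_num), e1]
  · rw [State.reg_setReg_of_ne _ _ (by norm_num), e2, Nat.sub_add_cancel hd]
  · rw [State.reg_setReg_of_ne _ _ (by norm_num), e3, Nat.sub_add_cancel hd]
  · simp
  · intro i a ha
    rw [State.mem_setReg, m₆, hs, init_mem i ha]
  · rw [State.reg_setReg_of_ne _ _ (by norm_num), e7]
  · rw [State.reg_setReg_of_ne _ _ (by norm_num), e8]

/-- The reduction decides the tripartite problem. -/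
theorem exec_reduction (E : R.Env) :
    Exec (LDT1 α 0) E.W E.N R.reduction (.init (E.L 0 ++ E.L 1 ++ E.L 2))
      (3000 * (E.k.toNat ^ 4 * E.N)) (E.k.toNat ^ 3) fun s' =>
        IsTruthValue (s'.reg 0) (∃ x : Fin 3 → ℤ, (∀ i, x i ∈ E.L i) ∧ ∑ i, α i * x i = 0) := by
  have hkc : (E.k.toNat : ℤ) = E.k := Int.toNat_of_nonneg (by linarith [E.k_pos])
  have hcube : ((E.k.toNat ^ 3 : ℕ) : ℤ) = E.k ^ 3 := by push_cast; rw [hkc]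
  have hloop (s₁ : State) (c₁ : E.Ctx s₁) (e7 : s₁.reg 7 = 0) (e8 : s₁.reg 8 = 0) :=
    Exec.loop (B := LDT1 α 0) (W := E.W) (N := E.N) (s := s₁) (p := R.queryProgram)
      (e := lt (reg 7) (mul (mul (reg 6) (reg 6)) (reg 6))) (c := 1)
      (τ := 1000 * ((E.d + 1) * E.N)) (I := fun j s' => E.Ctx s' ∧ s'.reg 7 = j ∧
        IsTruthValue (s'.reg 8) (∃ t < j, E.QueryYes t)) (E.k.toNat ^ 3) (by
      rintro j - s' ⟨c, e7, -⟩
      refine ⟨fits c.bounded (by simp [Feasible, ConstLE, Expr.cost]), ?_⟩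
      simp only [Expr.eval, BinOp.eval, e7, c.reg6, ne_eq, ite_eq_right_iff, one_ne_zero,
        imp_false, not_not]
      rw [← Nat.cast_lt (α := ℤ), hcube]
      ring_nf) (by
      rintro j hj s' ⟨c, e7, e8⟩
      refine (c.exec_queryProgram (by rw [← hcube]; exact_mod_cast hj) e7 e8).mono le_rfl
        fun s'' ⟨c', f7, f8⟩ => ⟨c', f7, ?_⟩
      simpa only [Nat.lt_succ_iff_lt_or_eq, or_and_right, exists_or, exists_eq_left] using f8)
      ⟨c₁, by simpa using e7, by simpa [IsTruthValue] using e8⟩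
  simp only [mul_one] at hloop
  refine Exec.mono (.seq_free <| E.exec_setupProgram.mono le_rfl fun s₁ ⟨c₁, e7, e8⟩ =>
    Exec.seq (c := E.k.toNat ^ 3) (c' := 0) <| .mono (hloop s₁ c₁ e7 e8) le_rfl
    fun s₂ ⟨c₂, f7, f8⟩ => .assign (fits c₂.bounded ?_) ?_) ?_ fun _ h => h
  · simp [Feasible, ConstLE, Expr.cost]
  · rw [State.reg_setReg_self, Expr.eval]
    convert f8 using 1
    rw [R.exists_solution_iff E.base_pos E.lt_base_pow E.length_eq E.bound]
    refine exists_congr fun t => and_congr_left fun _ => ?_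
    rw [← Nat.cast_lt (α := ℤ), hcube]
    rfl
  -- There are `k ^ 3` rounds of cost proportional to `(d + 1) * N ≤ 2 * k * N`.
  · have hd : E.d ≤ E.k.toNat := by
      zify
      rw [hkc]
      exact E.d_le
    have hk : 1 ≤ E.k.toNat := E.one_le.trans hd
    have hN := E.queryLen_pos
    have h₁ : (E.d + 1) * E.N ≤ 2 * (E.k.toNat * E.N) := by nlinarith
    have h₂ : E.k.toNat ^ 3 * ((E.d + 1) * E.N) ≤ 2 * (E.k.toNat ^ 4 * E.N) := by
      calc _ ≤ E.k.toNat ^ 3 * (2 * (E.k.toNat * E.N)) := Nat.mul_le_mul_left _ h₁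
        _ = _ := by ring
    have h₃ : E.k.toNat ≤ E.k.toNat ^ 4 * E.N := by
      calc E.k.toNat ≤ E.k.toNat ^ 4 := Nat.le_self_pow (by norm_num) _
        _ ≤ _ := Nat.le_mul_of_pos_right _ hN
    have h₄ : E.k.toNat ^ 3 ≤ E.k.toNat ^ 4 * E.N := by
      calc E.k.toNat ^ 3 ≤ E.k.toNat ^ 4 := Nat.pow_le_pow_right hk (by norm_num)
        _ ≤ _ := Nat.le_mul_of_pos_right _ hN
    simp only [Expr.cost]
    nlinarith

end Env

end ReductionData

/-! ### The size of the parameters -/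

/-- `2 ^ d` grows more slowly than every power of `n`, if `d` is chosen minimal with
`2 n ^ 3 < 2 ^ (d * d)`. -/
theorem exists_pow_le_of_minimal (C e q : ℕ) :
    ∃ m₀ : ℕ, ∀ n d : ℕ, m₀ ≤ n → (∀ j < d, 1 ≤ j → 2 ^ (j * j) ≤ 2 * n ^ 3) →
      (C * 2 ^ (e * d)) ^ q ≤ n := by
  -- Chosen so that `j > b` implies `3 * (C + e * (j + 1)) * q + 1 ≤ j * j`: the square beats the
  -- linear exponent. Smaller `d` are absorbed by the threshold on `n`.
  let b := 3 * e * q + (3 * (C + e) * q + 1)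
  refine ⟨2 ^ ((C + e * (b + 1)) * q), fun n d hn hd => ?_⟩
  have hC : (C * 2 ^ (e * d)) ^ q ≤ 2 ^ ((C + e * d) * q) := by
    rw [pow_mul 2 (C + e * d) q, pow_add]
    exact Nat.pow_le_pow_left (Nat.mul_le_mul_right _ Nat.lt_two_pow_self.le) _
  refine hC.trans ?_
  by_cases hdb : d ≤ b + 1
  · refine (Nat.pow_le_pow_right (by norm_num) ?_).trans hn
    gcongr
  · obtain ⟨j, rfl⟩ : ∃ j, d = j + 1 := ⟨d - 1, by omega⟩
    have hj : b < j := by omega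
    have h := hd j (by omega) (by omega)
    have hexp : 3 * ((C + e * (j + 1)) * q) + 1 ≤ j * j := by
      have h₁ : j * b ≤ j * j := Nat.mul_le_mul_left _ hj.le
      have h₂ : 3 * (C + e) * q + 1 ≤ j * (3 * (C + e) * q + 1) :=
        Nat.le_mul_of_pos_left _ (by omega)
      have h₃ : j * b = 3 * (e * j * q) + j * (3 * (C + e) * q + 1) := by ring
      have h₄ : 3 * ((C + e * (j + 1)) * q) = 3 * (e * j * q) + 3 * (C + e) * q := by ring
      omega
    -- With `X` the exponent to be bounded, `2 ^ (3 * X + 1) ≤ 2 ^ (j * j) ≤ 2 * n ^ 3`; cancelling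
    -- `2` and taking cube roots gives `2 ^ X ≤ n`.
    have h₅ := (Nat.pow_le_pow_right (by norm_num : 0 < 2) hexp).trans h
    rw [pow_succ, mul_comm 3, pow_mul, mul_comm _ 2] at h₅
    exact le_of_pow_le_pow_left₀ (by norm_num) (by positivity)
      (Nat.le_of_mul_le_mul_left h₅ (by norm_num))

theorem exists_minimal_digits (n : ℕ) :
    ∃ d : ℕ, 1 ≤ d ∧ 2 * n ^ 3 < 2 ^ (d * d) ∧ ∀ j < d, 1 ≤ j → 2 ^ (j * j) ≤ 2 * n ^ 3 := by
  classical
  have hex : ∃ d : ℕ, 1 ≤ d ∧ 2 * n ^ 3 < 2 ^ (d * d) :=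
    ⟨2 * n ^ 3 + 1, by omega, Nat.lt_two_pow_self.trans_le
      (Nat.pow_le_pow_right (by norm_num) (by nlinarith))⟩
  obtain ⟨h₁, h₂⟩ := Nat.find_spec hex
  refine ⟨Nat.find hex, h₁, h₂, fun j hj hj₁ => ?_⟩
  by_contra! h
  exact Nat.find_min hex hj ⟨hj₁, h⟩

/-- For `j = d - 1 ≥ 1` one has `(j + 1) ^ 2 ≤ 3 * j ^ 2 + 1`, so minimality bounds the power by `2
* (2 * n ^ 3) ^ 3 = 2 ^ 4 * n ^ 9`, and `13 = 4 + 9`. -/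
theorem two_pow_sq_le {n d : ℕ} (h : ∀ j < d, 1 ≤ j → 2 ^ (j * j) ≤ 2 * n ^ 3) :
    2 ^ (d * d) ≤ (n + 2) ^ 13 := by
  rcases lt_or_ge d 2 with hd | hd
  · calc 2 ^ (d * d) ≤ 2 ^ 13 := Nat.pow_le_pow_right (by norm_num) (by nlinarith)
      _ ≤ (n + 2) ^ 13 := Nat.pow_le_pow_left (by omega) _
  · obtain ⟨j, rfl⟩ : ∃ j, d = j + 1 := ⟨d - 1, by omega⟩
    have hj := h j (by omega) (by omega)
    calc 2 ^ ((j + 1) * (j + 1)) ≤ 2 ^ (j * j * 3 + 1) :=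
          Nat.pow_le_pow_right (by norm_num) (by nlinarith)
      _ = (2 ^ (j * j)) ^ 3 * 2 := by rw [pow_succ, pow_mul]
      _ ≤ (2 * n ^ 3) ^ 3 * 2 := Nat.mul_le_mul_right _ (Nat.pow_le_pow_left hj _)
      _ = 2 ^ 4 * n ^ 9 := by ring
      _ ≤ (n + 2) ^ 4 * (n + 2) ^ 9 := by gcongr <;> omega
      _ = (n + 2) ^ 13 := by ring

theorem colourCount_le {S : ℤ} {s : ℕ} (hS₀ : 0 ≤ S) (hS : S ≤ 2 ^ s) (d : ℕ) :
    ReductionData.colourCount S (2 ^ d) d ≤ 2 ^ ((s + 3) * d) := by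
  have h₁ : (d : ℤ) + 1 ≤ 2 ^ d := by exact_mod_cast Nat.lt_two_pow_self
  have h₂ : (1 : ℤ) ≤ 2 ^ d * 2 ^ d := by
    rw [← pow_add]; exact one_le_pow₀ (by norm_num)
  have h₃ : (d : ℤ) * 2 ^ d * 2 ^ d + 1 ≤ 2 ^ d * (2 ^ d * 2 ^ d) := by nlinarith
  calc ReductionData.colourCount S (2 ^ d) d
      ≤ (2 ^ s) ^ d * (2 ^ d * (2 ^ d * 2 ^ d)) :=
        mul_le_mul (pow_le_pow_left₀ hS₀ hS _) h₃ (by positivity) (by positivity)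
    _ = 2 ^ ((s + 3) * d) := by rw [← pow_mul]; ring

namespace ReductionData

variable {α : Fin 3 → ℤ} (R : ReductionData α)

/-- An exponent that bounds the constants of the reduction. -/
theorem exists_exponent : ∃ s : ℕ, coeffNorm α ≤ 2 ^ s ∧ R.K * R.K ≤ 2 ^ s ∧
    R.padCoeff ≤ 2 ^ s ∧ R.padCoeff' ≤ 2 ^ s ∧ (∀ j, |R.shiftCoeff j| ≤ 2 ^ s) ∧
      (R.K * R.K) ^ 3 ≤ 2 ^ s := by
  let b := |coeffNorm α| + |R.K * R.K| + |R.padCoeff| + |R.padCoeff'| +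
    (∑ j, |R.shiftCoeff j|) + |(R.K * R.K) ^ 3|
  have hsum : 0 ≤ ∑ j, |R.shiftCoeff j| := Finset.sum_nonneg fun _ _ => abs_nonneg _
  have hb : b ≤ 2 ^ b.toNat := by
    have : 0 ≤ b := by positivity
    have h : (b.toNat : ℤ) ≤ 2 ^ b.toNat := by exact_mod_cast Nat.lt_two_pow_self.le
    linarith [Int.toNat_of_nonneg this]
  have a₁ := abs_nonneg (coeffNorm α)
  have a₂ := abs_nonneg (R.K * R.K)
  have a₃ := abs_nonneg R.padCoeff
  have a₄ := abs_nonneg R.padCoeff'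
  have a₅ := abs_nonneg ((R.K * R.K) ^ 3)
  refine ⟨b.toNat, ?_, ?_, ?_, ?_, fun j => ?_, ?_⟩ <;> refine le_trans ?_ hb
  · linarith [le_abs_self (coeffNorm α)]
  · linarith [le_abs_self (R.K * R.K)]
  · linarith [le_abs_self R.padCoeff]
  · linarith [le_abs_self R.padCoeff']
  · have := Finset.single_le_sum (f := fun j => |R.shiftCoeff j|) (fun _ _ => abs_nonneg _)
      (Finset.mem_univ j)
    linarith
  · linarith [le_abs_self ((R.K * R.K) ^ 3)]

/-- Word lengths of `O(log n)` bits are enough. -/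
theorem exists_env : ∃ c s : ℕ, coeffNorm α ≤ 2 ^ s ∧
    ∀ (n : ℕ) (L : Fin 3 → List ℤ), (∀ i, (L i).length = n) → (∀ i, (L i).Nodup) →
      (∀ i, ∀ x ∈ L i, |x| ≤ (n : ℤ) ^ 3) → ∃ E : R.Env, E.n = n ∧ E.L = L ∧ E.W = (n + 2) ^ c := by
  obtain ⟨s, h₁, h₂, h₃, h₄, h₅, h₆⟩ := R.exists_exponent
  -- The cube of the number of colours is at most `(2 ^ (d * d)) ^ (3 * (s + 3))`, and `2 ^ (d * d)
  -- ≤ (n + 2) ^ 13`; this gives `39 = 13 * 3`. The further factor `100` in the word size is the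
  -- bound on the node count of feasible expressions.
  obtain ⟨e, he⟩ : ∃ e, e = 39 * (s + 3) := ⟨_, rfl⟩
  refine ⟨e * 100, s, h₁, fun n L hL hnd hb => ?_⟩
  obtain ⟨d, hd, hlt, hmin⟩ := exists_minimal_digits n
  have hsq := two_pow_sq_le hmin
  have hn : (2 : ℤ) ≤ n + 2 := by omega
  have hM (a : ℕ) (ha : a ≤ e) : ((n : ℤ) + 2) ^ a ≤ ((n + 2) ^ e : ℕ) := by
    push_cast
    exact pow_le_pow_right₀ (by linarith) ha
  have hpow : (2 : ℤ) ^ s ≤ ((n + 2) ^ e : ℕ) :=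
    (pow_le_pow_left₀ (by norm_num) hn s).trans (hM s (by omega))
  have hsq' : (2 : ℤ) ^ (d * d) ≤ ((n : ℤ) + 2) ^ 13 := by exact_mod_cast hsq
  refine ⟨⟨n, d, L, (n + 2) ^ e, (n + 2) ^ (e * 100), hL, hnd, hb, by exact_mod_cast hlt,
    (pow_mul _ _ _).ge, h₁.trans hpow, h₂.trans hpow, h₃.trans hpow, h₄.trans hpow,
    fun j => (h₅ j).trans hpow, ?_, hd, hsq'.trans (hM 13 (by omega)),
    fun j hj hj₁ => by exact_mod_cast hmin j hj hj₁, ?_⟩, rfl, rfl, rfl⟩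
  · have hU : (R.queryLen n : ℤ) = R.K * R.K * (n + 1) := by rw [cast_queryLen, U]; ring
    rw [hU, mul_pow]
    calc (R.K * R.K) ^ 3 * ((n : ℤ) + 1) ^ 3 ≤ 2 ^ s * ((n : ℤ) + 2) ^ 3 :=
          mul_le_mul h₆ (pow_le_pow_left₀ (by positivity) (by linarith) _) (by positivity)
            (by positivity)
      _ ≤ ((n : ℤ) + 2) ^ s * ((n : ℤ) + 2) ^ 3 := by gcongr
      _ = ((n : ℤ) + 2) ^ (s + 3) := by rw [pow_add]
      _ ≤ _ := hM _ (by omega)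
  · have hk₀ : 0 ≤ colourCount (coeffNorm α) (2 ^ d) d :=
      mul_nonneg (pow_pos R.coeffNorm_pos _).le (by positivity)
    calc colourCount (coeffNorm α) (2 ^ d) d ^ 3 ≤ (2 ^ ((s + 3) * d)) ^ 3 :=
          pow_le_pow_left₀ hk₀ (colourCount_le R.coeffNorm_pos.le h₁ d) 3
      _ = (2 ^ d) ^ (3 * (s + 3)) := by rw [← pow_mul, ← pow_mul]; ring_nf
      _ ≤ (2 ^ (d * d)) ^ (3 * (s + 3)) := by
          gcongr
          · norm_num
          · exact Nat.le_mul_self d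
      _ ≤ (((n : ℤ) + 2) ^ 13) ^ (3 * (s + 3)) := pow_le_pow_left₀ (by positivity) hsq' _
      _ = ((n : ℤ) + 2) ^ e := by rw [← pow_mul]; rw [he]; congr 1; ring
      _ ≤ _ := hM e le_rfl

/-- The number of colours is subpolynomial. -/
theorem exists_count_le {s : ℕ} (hs : coeffNorm α ≤ 2 ^ s) {η : ℝ} (hη : 0 < η) (C : ℕ) :
    ∃ m₀ : ℕ, 1 ≤ m₀ ∧ ∀ E : R.Env, m₀ ≤ E.n →
      (C : ℝ) * (E.k.toNat : ℝ) ^ 4 ≤ (E.n : ℝ) ^ η := by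
  -- An integer root suffices: the `(q + 1)`-th power of the bound is at most `n`, and `1 / (q + 1)
  -- < η`.
  obtain ⟨q, hq⟩ := exists_nat_one_div_lt hη
  obtain ⟨m₀, hm₀⟩ := exists_pow_le_of_minimal C ((s + 3) * 4) (q + 1)
  refine ⟨m₀ + 1, by omega, fun E hE => ?_⟩
  have hn : (1 : ℝ) ≤ E.n := by exact_mod_cast (by omega : 1 ≤ E.n)
  have h := hm₀ E.n E.d (by omega) fun j hj hj₁ => by exact_mod_cast E.minimal j hj hj₁
  have hk : (E.k.toNat : ℝ) ≤ 2 ^ ((s + 3) * E.d) := by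
    have h₁ : E.k ≤ 2 ^ ((s + 3) * E.d) := colourCount_le R.coeffNorm_pos.le hs E.d
    have h₂ : (E.k.toNat : ℤ) = E.k := Int.toNat_of_nonneg (by linarith [E.k_pos])
    rw [← h₂] at h₁
    exact_mod_cast h₁
  have h' : ((C : ℝ) * 2 ^ ((s + 3) * 4 * E.d)) ^ (q + 1) ≤ E.n := by exact_mod_cast h
  calc (C : ℝ) * (E.k.toNat : ℝ) ^ 4 ≤ C * (2 ^ ((s + 3) * E.d)) ^ 4 := by gcongr
    _ = (C : ℝ) * 2 ^ ((s + 3) * 4 * E.d) := by rw [← pow_mul]; ring_nf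
    _ = (((C : ℝ) * 2 ^ ((s + 3) * 4 * E.d)) ^ (q + 1)) ^ (1 / ((q : ℝ) + 1)) := by
        rw [one_div, ← Nat.cast_succ, Real.pow_rpow_inv_natCast (by positivity) (by omega)]
    _ ≤ (E.n : ℝ) ^ (1 / ((q : ℝ) + 1)) := Real.rpow_le_rpow (by positivity) h' (by positivity)
    _ ≤ (E.n : ℝ) ^ η := Real.rpow_le_rpow_of_exponent_le hn hq.le

end ReductionData

/-! ### Choice of the exponents and conclusion -/

theorem mainTheorem3 (α : Fin 3 → ℤ) (hα : ∀ i, α i ≠ 0) : LDT3 α 0 ≤₂ LDT1 α 0 := by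
  obtain ⟨R⟩ := ReductionData.nonempty hα
  obtain ⟨c, s, hs, henv⟩ := R.exists_env
  have hK₀ := R.scale_pos
  have hKR : (1 : ℝ) ≤ R.K := by exact_mod_cast hK₀
  refine ⟨R.reduction, c, fun ε hε => ?_⟩
  -- From `2 * δ ≤ ε` the oracle cost is at most `k ^ 3 * N ^ (2 - 2 * δ)`, which leaves a factor `n
  -- ^ δ` to absorb the number of queries; `2 * δ ≤ 1` gives `1 + δ ≤ 2 - δ` for the running time.
  set δ := min ε 1 / 2 with hδ
  have hδ₀ : 0 < δ := by positivity
  have hδε : 2 * δ ≤ ε := by linarith [min_le_left ε 1]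
  have hδ₁ : 2 * δ ≤ 1 := by linarith [min_le_right ε 1]
  -- The constant covers both estimates: `3000 * 2 * K ^ 2` for the time and `4 * K ^ 4` for the
  -- queries. Since it is absorbed into `n ^ δ`, the implied constant of the running time can be
  -- `1`.
  obtain ⟨m₀, hm₀, hcount⟩ := R.exists_count_le hs hδ₀ (6000 * R.K.toNat ^ 4)
  refine ⟨δ, hδ₀, 1, m₀, ?_⟩
  rintro ⟨n, A, hA, hbound⟩ l ⟨L, hL, rfl⟩
  obtain ⟨E, rfl, rfl, hW⟩ := henv n L (fun i => (hL i).length_eq.trans (hA i))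
    (fun i => (hL i).1) fun i x hx => hbound i x (((hL i).2 x).1 hx)
  obtain ⟨s', T, hrun, hT, hans⟩ := E.exec_reduction
  rw [hW] at hrun
  have hyes : (∃ x : Fin 3 → ℤ, (∀ i, x i ∈ E.L i) ∧ ∑ i, α i * x i = 0) ↔
      (LDT3 α 0).Yes ⟨E.n, A, hA, hbound⟩ := by
    simp [LDT3, (hL _).2]
  rw [hyes] at hans
  refine ⟨s', T, _, hrun, hans.1, hans.2, fun hn => ?_⟩
  change m₀ ≤ E.n at hn
  change (T : ℝ) ≤ 1 * (E.n : ℝ) ^ (2 - δ) ∧ _ ≤ (E.n : ℝ) ^ (2 - δ)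
  have hcnt := hcount E hn
  have hn₁ : (1 : ℝ) ≤ E.n := by exact_mod_cast hm₀.trans hn
  have hn₀ : (0 : ℝ) < E.n := by linarith
  have hk : (1 : ℝ) ≤ E.k.toNat := by
    have := E.k_pos
    exact_mod_cast (by omega : 1 ≤ E.k.toNat)
  have hKcast : ((R.K.toNat : ℕ) : ℝ) = R.K := by
    exact_mod_cast congrArg (Int.cast (R := ℝ)) (Int.toNat_of_nonneg hK₀.le)
  push_cast [hKcast] at hcnt
  have hN : (E.N : ℝ) = R.K * R.K * (E.n + 1) := by
    have h : (E.N : ℤ) = R.K * R.K * (E.n + 1) := by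
      rw [ReductionData.Env.N, R.cast_queryLen, ReductionData.U]; ring
    exact_mod_cast congrArg (Int.cast (R := ℝ)) h
  have hN₁ : (1 : ℝ) ≤ E.N := by exact_mod_cast E.queryLen_pos
  have hNle : (E.N : ℝ) ≤ 2 * (R.K : ℝ) ^ 2 * E.n := by rw [hN]; nlinarith
  have hK₂ : (R.K : ℝ) ^ 2 ≤ (R.K : ℝ) ^ 4 := pow_le_pow_right₀ hKR (by norm_num)
  constructor
  · calc (T : ℝ) ≤ 3000 * ((E.k.toNat : ℝ) ^ 4 * E.N) := by exact_mod_cast hT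
      _ ≤ 3000 * ((E.k.toNat : ℝ) ^ 4 * (2 * (R.K : ℝ) ^ 4 * E.n)) := by
          gcongr
          exact hNle.trans (by gcongr)
      _ = 6000 * (R.K : ℝ) ^ 4 * (E.k.toNat : ℝ) ^ 4 * E.n := by ring
      _ ≤ (E.n : ℝ) ^ δ * E.n := by gcongr
      _ = (E.n : ℝ) ^ (δ + 1) := by rw [Real.rpow_add hn₀, Real.rpow_one]
      _ ≤ (E.n : ℝ) ^ (2 - δ) := Real.rpow_le_rpow_of_exponent_le hn₁ (by linarith)
      _ = 1 * (E.n : ℝ) ^ (2 - δ) := (one_mul _).symm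
  · rw [List.map_replicate, List.sum_replicate, nsmul_eq_mul]
    have hpow : (E.N : ℝ) ^ (2 - ε) ≤ 4 * (R.K : ℝ) ^ 4 * (E.n : ℝ) ^ (2 - 2 * δ) := by
      have h2K : (1 : ℝ) ≤ 2 * (R.K : ℝ) ^ 2 := by nlinarith
      calc (E.N : ℝ) ^ (2 - ε) ≤ (E.N : ℝ) ^ (2 - 2 * δ) :=
            Real.rpow_le_rpow_of_exponent_le hN₁ (by linarith)
        _ ≤ (2 * (R.K : ℝ) ^ 2 * E.n) ^ (2 - 2 * δ) :=
            Real.rpow_le_rpow (by linarith) hNle (by linarith)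
        _ = (2 * (R.K : ℝ) ^ 2) ^ (2 - 2 * δ) * (E.n : ℝ) ^ (2 - 2 * δ) :=
            Real.mul_rpow (by positivity) (by positivity)
        _ ≤ (2 * (R.K : ℝ) ^ 2) ^ (2 : ℝ) * (E.n : ℝ) ^ (2 - 2 * δ) := by
            gcongr
            linarith
        _ = 4 * (R.K : ℝ) ^ 4 * (E.n : ℝ) ^ (2 - 2 * δ) := by
            rw [Real.rpow_two]; ring
    have hk₃ : (E.k.toNat : ℝ) ^ 3 ≤ (E.k.toNat : ℝ) ^ 4 := pow_le_pow_right₀ hk (by norm_num)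
    calc ((E.k.toNat ^ 3 : ℕ) : ℝ) * (E.N : ℝ) ^ (2 - ε)
        ≤ (E.k.toNat : ℝ) ^ 4 * (4 * (R.K : ℝ) ^ 4 * (E.n : ℝ) ^ (2 - 2 * δ)) := by
          push_cast
          gcongr
      _ = 4 * (R.K : ℝ) ^ 4 * (E.k.toNat : ℝ) ^ 4 * (E.n : ℝ) ^ (2 - 2 * δ) := by ring
      _ ≤ 6000 * (R.K : ℝ) ^ 4 * (E.k.toNat : ℝ) ^ 4 * (E.n : ℝ) ^ (2 - 2 * δ) := by
          gcongr
          norm_num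
      _ ≤ (E.n : ℝ) ^ δ * (E.n : ℝ) ^ (2 - 2 * δ) := by gcongr
      _ = (E.n : ℝ) ^ (2 - δ) := by rw [← Real.rpow_add hn₀]; congr 1; ring
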